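/- Let $f(z,w)=(p(z),q(z,w))$ be a polynomial skew product on $\mathbb{C}^2$, where $p(z)=a_\delta z^\delta+o(z^\delta)$ is a polynomial of degree $\delta\ge 2$ and $q(z,w)=\sum_{i,j\ge 0} b_{ij}z^iw^j$ is a polynomial of (total) degree at least $2$. Let $N(q)\subset\mathbb{R}^2$ be the convex hull of the union of the quadrants $D(i,j)=\{(x,y): x\le i,\ y\le j\}$ over all $(i,j)$ with $b_{ij}\ne 0$. Let $(n_1,m_1),\dots,(n_s,m_s)$ be its vertices, with $n_1<\cdots<n_s$ and $m_1>\cdots>m_s$. For $1\le k\le s-1$ let $T_k$ be the $y$-intercept of the line through $(n_k,m_k)$ and $(n_{k+1},m_{k+1})$. Choose $(\gamma,d)$ and weights $0\le l_1<\infty$, $0<l_2\le\infty$ as in one of the following cases whose condition holds (if $\delta=T_k$ for some $k$, two choices are possible, and the statement holds for each of them that satisfies the hypothesis below): 1. $s=1$: $(\gamma,d)=(n_1,m_1)$, $l_1=0$, $l_2=\infty$. 2. $s>1$ and $\delta\le T_1$: $(\gamma,d)=(n_1,m_1)$, $l_1=\frac{n_2-n_1}{m_1-m_2}$, $l_2=\infty$.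 3. $s>1$ and $T_{s-1}\le\delta$: $(\gamma,d)=(n_s,m_s)$, $l_1=0$, $l_2=\frac{n_s-n_{s-1}}{m_{s-1}-m_s}$. 4. $s>2$ and $T_{k-1}\le\delta\le T_k$ for some $2\le k\le s-1$: $(\gamma,d)=(n_k,m_k)$, $l_1=\frac{n_{k+1}-n_k}{m_k-m_{k+1}}$, $l_1+l_2=\frac{n_k-n_{k-1}}{m_{k-1}-m_k}$. For $R>0$ put $$U_R=\{(z,w)\in\mathbb{C}^2: |z|^{l_1+l_2}>R^{l_2}|w|,\ |w|>R|z|^{l_1}\},$$ where for $l_2=\infty$ the first inequality is read as $|z|>R$. Let $f_0(z,w)=(a_\delta z^\delta,\ b_{\gamma d}z^\gamma w^d)$. Assume that $d\ge 2$, or that $d=1$ and $\delta\ne T_k$ for every $1\le k\le s-1$. Then there are $R_0>0$ and a map $\phi=(\phi_1,\phi_2)$ such that for every $R\ge R_0$ one has $f(U_R)\subset U_R$, the map $\phi$ is biholomorphic from $U_R$ onto the open set $\phi(U_R)\subset\mathbb{C}^2$, and $\phi\circ f=f_0\circ\phi$ on $U_R$. Moreover, for every $\varepsilon>0$ there is $R_1\ge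 R_0$ such that for every $R\ge R_1$ $$|\phi_1(z,w)-z|<\varepsilon|z|\quad\text{and}\quad|\phi_2(z,w)-w|<\varepsilon|w|\qquad\text{for all }(z,w)\in U_R .$$ -/

import Mathlib

open Set

noncomputable section

namespace SkewBottcher

/-- The polynomial skew product `f(z, w) = (p(z), q(z, w))` on `ℂ²`; variable `0` of `q` is `z` and
variable `1` is `w`. -/
def skewProduct (p : Polynomial ℂ) (q : MvPolynomial (Fin 2) ℂ) (x : ℂ × ℂ) : ℂ × ℂ :=
  (p.eval x.1, MvPolynomial.eval ![x.1, x.2] q)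

/-- The coefficient `b_{ij}` of `z ^ i * w ^ j` in `q`. -/
def bCoeff (q : MvPolynomial (Fin 2) ℂ) (i j : ℕ) : ℂ :=
  q.coeff (Finsupp.single 0 i + Finsupp.single 1 j)

/-- The monomial map `f₀(z, w) = (a z ^ δ, b z ^ γ w ^ d)`. -/
def monomialMap (a b : ℂ) (δ γ d : ℕ) (x : ℂ × ℂ) : ℂ × ℂ :=
  (a * x.1 ^ δ, b * x.1 ^ γ * x.2 ^ d)

/-- The quadrant `D(i, j) = {(x, y) | x ≤ i, y ≤ j}` in the real plane. -/
def quadrant (i j : ℕ) : Set (ℝ × ℝ) :=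
  {x | x.1 ≤ (i : ℝ) ∧ x.2 ≤ (j : ℝ)}

/-- The (reversed) Newton polygon `N(q)`: the convex hull of the union of the quadrants `D(i, j)`
over all `(i, j)` with `b_{ij} ≠ 0`. -/
def newtonPolygon (q : MvPolynomial (Fin 2) ℂ) : Set (ℝ × ℝ) :=
  convexHull ℝ {x | ∃ i j : ℕ, bCoeff q i j ≠ 0 ∧ x ∈ quadrant i j}

/-- `(n 1, m 1), …, (n s, m s)` are the vertices of `N(q)`, listed so that
`n 1 < ⋯ < n s` and `m 1 > ⋯ > m s`. Values of `n` and `m` outside `1, …, s` play no role. -/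
structure IsVertexList (q : MvPolynomial (Fin 2) ℂ) (s : ℕ) (n m : ℕ → ℕ) : Prop where
  strictMonoOn : StrictMonoOn n (Icc 1 s)
  strictAntiOn : StrictAntiOn m (Icc 1 s)
  vertices : (fun k => ((n k : ℝ), (m k : ℝ))) '' Icc 1 s = (newtonPolygon q).extremePoints ℝ

/-- `T_k`, the `y`-intercept of the line through `(n k, m k)` and `(n (k + 1), m (k + 1))`. -/
def yIntercept (n m : ℕ → ℕ) (k : ℕ) : ℝ :=
  (m k : ℝ) + (n k : ℝ) * (((m k : ℝ) - m (k + 1)) / ((n (k + 1) : ℝ) - n k))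

/-- The number `(n (k + 1) - n k) / (m k - m (k + 1))`: the slope of the `k`-th edge of the Newton
polygon is minus its inverse. -/
def edgeWeight (n m : ℕ → ℕ) (k : ℕ) : ℝ :=
  ((n (k + 1) : ℝ) - n k) / ((m k : ℝ) - m (k + 1))

/-- `IsDominant δ s n m γ d l₁ l₂` says that `(γ, d)` is a dominant exponent, with weights
`0 ≤ l₁ < ∞` and `0 < l₂ ≤ ∞`, for the degree `δ` and the vertices `(n k, m k)`, `1 ≤ k ≤ s`.
If `δ` is equal to some `T_k`, there are two possible choices. -/
inductive IsDominant (δ s : ℕ) (n m : ℕ → ℕ) : ℕ → ℕ → ℝ → WithTop ℝ → Prop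
  | case1 (hs : s = 1) : IsDominant δ s n m (n 1) (m 1) 0 ⊤
  | case2 (hs : 1 < s) (h : (δ : ℝ) ≤ yIntercept n m 1) :
      IsDominant δ s n m (n 1) (m 1) (edgeWeight n m 1) ⊤
  | case3 (hs : 1 < s) (h : yIntercept n m (s - 1) ≤ (δ : ℝ)) :
      IsDominant δ s n m (n s) (m s) 0 (edgeWeight n m (s - 1) : ℝ)
  | case4 (k : ℕ) (hk : 2 ≤ k) (hks : k + 1 ≤ s)
      (h₁ : yIntercept n m (k - 1) ≤ (δ : ℝ)) (h₂ : (δ : ℝ) ≤ yIntercept n m k) :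
      IsDominant δ s n m (n k) (m k) (edgeWeight n m k)
        ((edgeWeight n m (k - 1) - edgeWeight n m k : ℝ) : WithTop ℝ)

/-- The region `U = {|z| ^ (l₁ + l₂) > R ^ l₂ * |w|, |w| > R * |z| ^ l₁}`, where for `l₂ = ∞` the
first inequality is read as `|z| > R`. -/
def region (l₁ : ℝ) : WithTop ℝ → ℝ → Set (ℂ × ℂ)
  | ⊤, R => {x | R < ‖x.1‖ ∧ R * ‖x.1‖ ^ l₁ < ‖x.2‖}
  | (l₂ : ℝ), R => {x | R ^ l₂ * ‖x.2‖ < ‖x.1‖ ^ (l₁ + l₂) ∧ R * ‖x.1‖ ^ l₁ < ‖x.2‖}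

/-- `φ` is biholomorphic from the open set `U` onto its image, an open set. -/
structure IsBiholomorphicOn (φ : ℂ × ℂ → ℂ × ℂ) (U : Set (ℂ × ℂ)) : Prop where
  isOpen_source : IsOpen U
  isOpen_image : IsOpen (φ '' U)
  holomorphic : DifferentiableOn ℂ φ U
  exists_inverse : ∃ ψ : ℂ × ℂ → ℂ × ℂ, DifferentiableOn ℂ ψ (φ '' U) ∧ LeftInvOn ψ φ U

end SkewBottcher

end

open Set

noncomputable section

namespace SkewBottcher

/-! In the coordinates X = log|z|, Y = log|w|, ρ = log R, with κ = 1/(l₁ + l₂) (κ = 0 if l₂ = ∞),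
the region is the wedge P = Y - l₁X > ρ, Q = X - κY > (1 - κl₁)ρ. The edges of N(q) adjacent to (γ,
d) make every other monomial of q smaller than the dominant one by a factor exp(-eρ) there, so f is
f₀ times 1 + O(exp(-eρ)) in each coordinate (`exists_norm_div_monomial_sub_one_le`).

The map f₀ acts by (X, Y) ↦ (δX, γX + dY). It increases P by (d - 1)P + (γ + l₁d - l₁δ)X and Q by (d
- 1)Q + (δ - κγ - d)X. The bounds T_{k-1} ≤ δ ≤ T_k say exactly that the coefficients of X are
nonnegative; for d = 1 strictness is what keeps the gain positive. If κ = 0, then Q = X and δ ≥ 2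
suffices. Hence, for large ρ, f sends level ρ into level ρ + 1.

Seek φ = (z exp A, w exp B). With u₁, u₂ the quotients of the components of f by those of f₀, the
conjugacy follows from A = (log u₁ + A∘f)/δ and B = (log u₂ - γA + B∘f)/d.
`exists_cohomological_solution` solves both by series along the orbit; the right-hand sides decay
geometrically there, so even d = 1 converges. A and B are then O(exp(-eρ)), which gives the
asymptotics. In logarithmic coordinates φ is the identity plus a 1/2-Lipschitz periodic map on a
convex set, hence biholomorphic (`isBiholomorphicOn_expTwist`). The inequalities linking N(q), δ and
the weights are collected in `IsDominant.exists_weights`. -/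

open Metric Filter Topology

/-! ### Holomorphic series along orbits -/

section Series

variable {E : Type*} [NormedAddCommGroup E] [NormedSpace ℂ E]
  {F : Type*} [NormedAddCommGroup F] [NormedSpace ℂ F]

/-- Cauchy estimate for the derivative of a bounded holomorphic map on a ball. -/
theorem norm_fderiv_le_of_norm_le_on_ball {f : E → F} {c : E} {r M : ℝ} (hr : 0 < r)
    (hf : DifferentiableOn ℂ f (ball c r)) (hM : ∀ x ∈ ball c r, ‖f x‖ ≤ M) :
    ‖fderiv ℂ f c‖ ≤ 2 * M / r := by
  refine Complex.norm_fderiv_le_div_of_mapsTo_ball hf (fun x hx => ?_) hr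
  have h₁ := hM x hx
  have h₂ := hM c (mem_ball_self hr)
  rw [mem_closedBall, dist_eq_norm]
  linarith [norm_sub_le (f x) (f c)]

/-- A uniformly summable series of holomorphic maps is holomorphic. -/
theorem differentiableOn_tsum_of_norm_le [CompleteSpace F] {f : ℕ → E → F} {U : Set E} {u : ℕ → ℝ}
    (hU : IsOpen U) (hu : Summable u) (hf : ∀ k, DifferentiableOn ℂ (f k) U)
    (hfu : ∀ k, ∀ x ∈ U, ‖f k x‖ ≤ u k) :
    DifferentiableOn ℂ (fun x => ∑' k, f k x) U := by
  intro x hx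
  obtain ⟨r, hr, hrU⟩ := Metric.isOpen_iff.1 hU x hx
  -- Halving the radius gives one Cauchy radius for all points near `x`, so the series of
  -- derivatives is uniformly summable too.
  have hsub : ∀ y ∈ ball x (r / 2), ball y (r / 2) ⊆ U := fun y hy =>
    (ball_subset_ball' (by rw [mem_ball] at hy; linarith)).trans hrU
  have hmem : ∀ y ∈ ball x (r / 2), y ∈ U := fun y hy =>
    hsub y hy (mem_ball_self (half_pos hr))
  have hx' : x ∈ ball x (r / 2) := mem_ball_self (half_pos hr)
  refine (hasFDerivAt_tsum_of_isPreconnected (f' := fun k y => fderiv ℂ (f k) y)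
    (u := fun k => 2 * u k / (r / 2)) ((hu.mul_left 2).div_const _) isOpen_ball
    (convex_ball x (r / 2)).isPreconnected
    (fun k y hy => ((hf k).differentiableAt (hU.mem_nhds (hmem y hy))).hasFDerivAt)
    (fun k y hy => norm_fderiv_le_of_norm_le_on_ball (half_pos hr) ((hf k).mono (hsub y hy))
      fun z hz => hfu k z (hsub y hy hz)) hx'
    (Summable.of_norm_bounded hu fun k => hfu k x hx) hx').differentiableAt.differentiableWithinAt

/-- Holomorphic solution of the cohomological equation `G = a (g + G ∘ f)` on a family of domains
that `f` pushes towards the end at which `g` decays. -/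
theorem exists_cohomological_solution {U : ℝ → Set E} {f : E → E} {g : E → ℂ} {a : ℂ}
    {ρ₀ c C : ℝ} (hU : ∀ ρ, IsOpen (U ρ)) (hUf : ∀ ρ, ρ₀ ≤ ρ → MapsTo f (U ρ) (U (ρ + 1)))
    (hanti : Antitone U) (hf : Differentiable ℂ f) (hg : DifferentiableOn ℂ g (U ρ₀)) (hc : 0 < c)
    (hgC : ∀ ρ, ρ₀ ≤ ρ → ∀ x ∈ U ρ, ‖g x‖ ≤ C * Real.exp (-c * ρ)) (ha : ‖a‖ ≤ 1) :
    ∃ (G : E → ℂ) (C' : ℝ), DifferentiableOn ℂ G (U ρ₀) ∧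
      (∀ ρ, ρ₀ ≤ ρ → ∀ x ∈ U ρ, ‖G x‖ ≤ C' * Real.exp (-c * ρ)) ∧
      ∀ x ∈ U ρ₀, G x = a * (g x + G (f x)) := by
  have hiter : ∀ (k : ℕ) (ρ : ℝ), ρ₀ ≤ ρ → MapsTo f^[k] (U ρ) (U (ρ + k)) := by
    intro k
    induction k with
    | zero => intro ρ _ x hx; simpa using hx
    | succ k ih =>
      intro ρ hρ x hx
      rw [Function.iterate_succ_apply']
      have := hUf (ρ + k) (by linarith [(Nat.cast_nonneg k : (0 : ℝ) ≤ k)]) (ih ρ hρ hx)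
      rwa [Nat.cast_succ, ← add_assoc]
  have hfk : ∀ k : ℕ, Differentiable ℂ f^[k] := fun k => hf.iterate k
  have hbound : ∀ ρ, ρ₀ ≤ ρ → ∀ x ∈ U ρ, ∀ k : ℕ, ‖a ^ (k + 1) * g (f^[k] x)‖ ≤
      C * Real.exp (-c * ρ) * Real.exp (-c) ^ k := by
    intro ρ hρ x hx k
    have h := hgC (ρ + k) (by linarith [(Nat.cast_nonneg k : (0 : ℝ) ≤ k)]) _ (hiter k ρ hρ hx)
    rw [norm_mul, norm_pow]
    calc ‖a‖ ^ (k + 1) * ‖g (f^[k] x)‖ ≤ 1 * (C * Real.exp (-c * (ρ + k))) :=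
          mul_le_mul (pow_le_one₀ (norm_nonneg a) ha) h (norm_nonneg _) zero_le_one
      _ = C * Real.exp (-c * ρ) * Real.exp (-c) ^ k := by
          rw [← Real.exp_nat_mul, mul_assoc, ← Real.exp_add, one_mul]
          ring_nf
  have hlt : Real.exp (-c) < 1 := by rw [Real.exp_lt_one_iff]; linarith
  have hgeo : Summable fun k : ℕ => Real.exp (-c) ^ k :=
    summable_geometric_of_lt_one (Real.exp_pos _).le hlt
  have hsum : ∀ x ∈ U ρ₀, Summable fun k : ℕ => a ^ (k + 1) * g (f^[k] x) := fun x hx =>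
    Summable.of_norm_bounded (hgeo.mul_left _) (hbound ρ₀ le_rfl x hx)
  -- Iterating the equation forces this series. Convergence comes from the decay of `g` along the
  -- orbit, not from `a`, whose modulus may be 1.
  refine ⟨fun x => ∑' k : ℕ, a ^ (k + 1) * g (f^[k] x), C * (1 - Real.exp (-c))⁻¹, ?_, ?_, ?_⟩
  · refine differentiableOn_tsum_of_norm_le (hU ρ₀) (hgeo.mul_left (C * Real.exp (-c * ρ₀)))
      (fun k => ?_) (fun k x hx => hbound ρ₀ le_rfl x hx k)
    refine (hg.comp (hfk k).differentiableOn fun x hx => ?_).const_mul _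
    exact hanti (by linarith [(Nat.cast_nonneg k : (0 : ℝ) ≤ k)]) (hiter k ρ₀ le_rfl hx)
  · intro ρ hρ x hx
    refine (tsum_of_norm_bounded ((hasSum_geometric_of_lt_one (Real.exp_pos _).le hlt).mul_left _)
      (hbound ρ hρ x hx)).trans_eq (by ring)
  · intro x hx
    simp only
    rw [(hsum x hx).tsum_eq_zero_add, mul_add, ← tsum_mul_left]
    simp only [Function.iterate_zero, id, zero_add, pow_one, Function.iterate_succ_apply]
    congr 1
    refine tsum_congr fun k => ?_
    ring

end Series

/-! ### Biholomorphy through logarithmic coordinates -/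

section Biholomorphic

/-- An injective open holomorphic map whose derivatives are injective is biholomorphic. -/
theorem isBiholomorphicOn_of_injOn {φ : ℂ × ℂ → ℂ × ℂ} {U : Set (ℂ × ℂ)} (hU : IsOpen U)
    (hφ : DifferentiableOn ℂ φ U) (hinj : InjOn φ U)
    (hopen : ∀ W ⊆ U, IsOpen W → IsOpen (φ '' W))
    (hder : ∀ x ∈ U, Function.Injective (fderiv ℂ φ x)) : IsBiholomorphicOn φ U := by
  refine ⟨hU, hopen U Subset.rfl hU, hφ, Function.invFunOn φ U, ?_, hinj.leftInvOn_invFunOn⟩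
  set ψ := Function.invFunOn φ U
  have hψ : LeftInvOn ψ φ U := hinj.leftInvOn_invFunOn
  rintro _ ⟨x, hx, rfl⟩
  let e : (ℂ × ℂ) ≃L[ℂ] (ℂ × ℂ) :=
    (LinearEquiv.ofInjectiveEndo (fderiv ℂ φ x : ℂ × ℂ →ₗ[ℂ] ℂ × ℂ)
      (hder x hx)).toContinuousLinearEquiv
  have he : (e : ℂ × ℂ →L[ℂ] ℂ × ℂ) = fderiv ℂ φ x := by
    ext <;> rfl
  have hcont : ContinuousAt ψ (φ x) := by
    intro N hN
    rw [hψ hx] at hN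
    obtain ⟨W, hWN, hW, hxW⟩ := _root_.mem_nhds_iff.1 (inter_mem hN (hU.mem_nhds hx))
    have hWU : W ⊆ U := hWN.trans inter_subset_right
    rw [Filter.mem_map]
    refine mem_of_superset ((hopen W hWU hW).mem_nhds (mem_image_of_mem φ hxW)) ?_
    rintro _ ⟨y, hy, rfl⟩
    rw [mem_preimage, hψ (hWU hy)]
    exact (hWN hy).1
  have hd : HasFDerivAt φ (e : ℂ × ℂ →L[ℂ] ℂ × ℂ) (ψ (φ x)) := by
    rw [hψ hx, he]
    exact (hφ.differentiableAt (hU.mem_nhds hx)).hasFDerivAt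
  have hev : ∀ᶠ y in 𝓝 (φ x), φ (ψ y) = y := by
    filter_upwards [(hopen U Subset.rfl hU).mem_nhds (mem_image_of_mem φ hx)]
    rintro _ ⟨y, hy, rfl⟩
    rw [hψ hy]
  exact (hd.of_local_left_inverse hcont hev).differentiableAt.differentiableWithinAt

/-- The covering `(u, v) ↦ (exp u, exp v)` of `(ℂ ∖ {0})²`. -/
def expMap (u : ℂ × ℂ) : ℂ × ℂ := (Complex.exp u.1, Complex.exp u.2)

theorem differentiable_expMap : Differentiable ℂ expMap := by
  unfold expMap
  fun_prop

theorem isOpenMap_expMap : IsOpenMap expMap :=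
  Complex.isOpenMap_exp.prodMap Complex.isOpenMap_exp

theorem exists_expMap_eq {x : ℂ × ℂ} (h₁ : x.1 ≠ 0) (h₂ : x.2 ≠ 0) : ∃ u, expMap u = x :=
  ⟨(Complex.log x.1, Complex.log x.2), Prod.ext (Complex.exp_log h₁) (Complex.exp_log h₂)⟩

theorem expMap_add (u v : ℂ × ℂ) : expMap (u + v) = expMap u * expMap v :=
  Prod.ext (Complex.exp_add _ _) (Complex.exp_add _ _)

theorem exists_period_of_expMap_eq {u v : ℂ × ℂ} (h : expMap u = expMap v) :
    ∃ t : ℂ × ℂ, u = v + t ∧ expMap t = 1 := by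
  refine ⟨u - v, by abel, ?_⟩
  have h₁ := Complex.exp_eq_exp_iff_exp_sub_eq_one.1 (congrArg Prod.fst h)
  have h₂ := Complex.exp_eq_exp_iff_exp_sub_eq_one.1 (congrArg Prod.snd h)
  exact Prod.ext h₁ h₂

theorem injective_fderiv_expMap (u : ℂ × ℂ) : Function.Injective (fderiv ℂ expMap u) := by
  have h : HasFDerivAt expMap
      ((Complex.exp u.1 • ContinuousLinearMap.fst ℂ ℂ ℂ).prod
        (Complex.exp u.2 • ContinuousLinearMap.snd ℂ ℂ ℂ)) u :=
    (hasFDerivAt_fst.cexp).prodMk (hasFDerivAt_snd.cexp)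
  rw [h.fderiv]
  intro x y hxy
  have h₁ := congrArg Prod.fst hxy
  have h₂ := congrArg Prod.snd hxy
  simp only [ContinuousLinearMap.prod_apply, smul_apply,
    ContinuousLinearMap.coe_fst', ContinuousLinearMap.coe_snd', smul_eq_mul] at h₁ h₂
  exact Prod.ext (mul_left_cancel₀ (Complex.exp_ne_zero _) h₁)
    (mul_left_cancel₀ (Complex.exp_ne_zero _) h₂)

/-- The map `(z, w) ↦ (z exp A, w exp B)`. -/
def expTwist (A B : ℂ × ℂ → ℂ) (x : ℂ × ℂ) : ℂ × ℂ :=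
  (x.1 * Complex.exp (A x), x.2 * Complex.exp (B x))

theorem expTwist_expMap (A B : ℂ × ℂ → ℂ) (u : ℂ × ℂ) :
    expTwist A B (expMap u) = expMap (u + (A (expMap u), B (expMap u))) := by
  rw [expMap_add]
  rfl

/-- If `A` and `B` are holomorphic and small on a neighbourhood of `U` which is uniform in
logarithmic coordinates, and `U` is convex in these coordinates, then `(z exp A, w exp B)` is
biholomorphic on `U`. -/
theorem isBiholomorphicOn_expTwist {A B : ℂ × ℂ → ℂ} {U U' : Set (ℂ × ℂ)} {r M : ℝ}
    (hU : IsOpen U) (hU₀ : ∀ x ∈ U, x.1 ≠ 0 ∧ x.2 ≠ 0) (hconv : Convex ℝ (expMap ⁻¹' U))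
    (hr : 0 < r) (hball : ∀ u ∈ expMap ⁻¹' U, ball u r ⊆ expMap ⁻¹' U')
    (hA : DifferentiableOn ℂ A U') (hB : DifferentiableOn ℂ B U')
    (hAM : ∀ x ∈ U', ‖A x‖ ≤ M) (hBM : ∀ x ∈ U', ‖B x‖ ≤ M) (hM : 2 * M / r ≤ 1 / 2) :
    IsBiholomorphicOn (expTwist A B) U := by
  set h : ℂ × ℂ → ℂ × ℂ := fun u => (A (expMap u), B (expMap u)) with hh
  set V := expMap ⁻¹' U with hV
  have hUU' : U ⊆ U' := by
    intro x hx
    obtain ⟨u, rfl⟩ := exists_expMap_eq (hU₀ x hx).1 (hU₀ x hx).2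
    exact hball u hx (mem_ball_self hr)
  have hhd : DifferentiableOn ℂ h (expMap ⁻¹' U') :=
    (hA.comp differentiable_expMap.differentiableOn fun u hu => hu).prodMk
      (hB.comp differentiable_expMap.differentiableOn fun u hu => hu)
  have hhM : ∀ u ∈ expMap ⁻¹' U', ‖h u‖ ≤ M := fun u hu =>
    max_le (hAM _ hu) (hBM _ hu)
  have hhder : ∀ u ∈ V, ‖fderiv ℂ h u‖ ≤ 1 / 2 := fun u hu =>
    (norm_fderiv_le_of_norm_le_on_ball hr (hhd.mono (hball u hu))
      fun y hy => hhM y (hball u hu hy)).trans hM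
  have hhat : ∀ u ∈ V, DifferentiableAt ℂ h u := fun u hu =>
    hhd.differentiableAt (mem_of_superset (ball_mem_nhds u hr) (hball u hu))
  have hlip : LipschitzOnWith (1 / 2) h V :=
    hconv.lipschitzOnWith_of_nnnorm_fderiv_le hhat fun u hu => by
      have := hhder u hu
      rw [← NNReal.coe_le_coe]
      simpa using this
  set Φ : ℂ × ℂ → ℂ × ℂ := fun u => u + h u with hΦ
  have hφΦ : ∀ u, expTwist A B (expMap u) = expMap (Φ u) := expTwist_expMap A B
  set I : (ℂ × ℂ) ≃L[ℂ] (ℂ × ℂ) := ContinuousLinearEquiv.refl ℂ (ℂ × ℂ)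
  have happ : ApproximatesLinearOn Φ (I : ℂ × ℂ →L[ℂ] ℂ × ℂ) V (1 / 2) := by
    refine LipschitzOnWith.approximatesLinearOn ?_
    have : Φ - ⇑(I : ℂ × ℂ →L[ℂ] ℂ × ℂ) = h := funext fun u => add_sub_cancel_left u (h u)
    rwa [this]
  have hnorm : (1 / 2 : NNReal) < ‖(I.symm : ℂ × ℂ →L[ℂ] ℂ × ℂ)‖₊⁻¹ := by
    have : ‖(I.symm : ℂ × ℂ →L[ℂ] ℂ × ℂ)‖₊ = 1 := by
      rw [← NNReal.coe_inj]
      exact ContinuousLinearMap.norm_id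
    rw [this, inv_one]
    exact NNReal.half_lt_self one_ne_zero
  have hΦinj : InjOn Φ V := happ.injOn (Or.inr hnorm)
  have hΦopen : ∀ W ⊆ V, IsOpen W → IsOpen (Φ '' W) := fun W hW hWo =>
    (happ.mono_set hW).open_image I.toNonlinearRightInverse hWo (Or.inr hnorm)
  have himage : ∀ W ⊆ U, expTwist A B '' W = expMap '' (Φ '' (expMap ⁻¹' W)) := by
    intro W hW
    ext y
    constructor
    · rintro ⟨x, hx, rfl⟩
      obtain ⟨u, rfl⟩ := exists_expMap_eq (hU₀ x (hW hx)).1 (hU₀ x (hW hx)).2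
      exact ⟨Φ u, ⟨u, hx, rfl⟩, (hφΦ u).symm⟩
    · rintro ⟨_, ⟨u, hu, rfl⟩, rfl⟩
      exact ⟨expMap u, hu, hφΦ u⟩
  have hφd : DifferentiableOn ℂ (expTwist A B) U := by
    have hA' := hA.mono hUU'
    have hB' := hB.mono hUU'
    exact (differentiableOn_fst.mul hA'.cexp).prodMk (differentiableOn_snd.mul hB'.cexp)
  refine isBiholomorphicOn_of_injOn hU hφd ?_ ?_ ?_
  · intro x hx y hy hxy
    obtain ⟨u, rfl⟩ := exists_expMap_eq (hU₀ x hx).1 (hU₀ x hx).2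
    obtain ⟨v, rfl⟩ := exists_expMap_eq (hU₀ y hy).1 (hU₀ y hy).2
    rw [hφΦ, hφΦ] at hxy
    -- Equal images only give Φ u = Φ v + t with t a period of `expMap`. Since `h` and `V` are
    -- invariant under periods, this reads Φ u = Φ (v + t), and injectivity upstairs applies.
    obtain ⟨t, ht, ht₁⟩ := exists_period_of_expMap_eq hxy
    have hper : expMap (v + t) = expMap v := by rw [expMap_add, ht₁, mul_one]
    have hvt : v + t ∈ V := by
      rw [hV, mem_preimage, hper]
      exact hy
    have : Φ u = Φ (v + t) := by
      rw [ht]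
      simp only [hΦ, hh, hper]
      abel
    rw [hΦinj hx hvt this, hper]
  · intro W hW hWo
    rw [himage W hW]
    exact isOpenMap_expMap _
      (hΦopen _ (preimage_mono hW) (hWo.preimage differentiable_expMap.continuous))
  · intro x hx
    obtain ⟨u, rfl⟩ := exists_expMap_eq (hU₀ x hx).1 (hU₀ x hx).2
    -- The chain rule for both sides of `hφΦ` transfers injectivity from id + Dh, where ‖Dh‖ ≤ 1/2,
    -- to the derivative downstairs.
    have h₁ : HasFDerivAt (expTwist A B ∘ expMap)
        ((fderiv ℂ (expTwist A B) (expMap u)).comp (fderiv ℂ expMap u)) u :=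
      (hφd.differentiableAt (hU.mem_nhds hx)).hasFDerivAt.comp u
        (differentiable_expMap u).hasFDerivAt
    have h₂ : HasFDerivAt (expMap ∘ Φ)
        ((fderiv ℂ expMap (Φ u)).comp (ContinuousLinearMap.id ℂ (ℂ × ℂ) + fderiv ℂ h u)) u :=
      (differentiable_expMap (Φ u)).hasFDerivAt.comp u
        ((hasFDerivAt_id u).add (hhat u hx).hasFDerivAt)
    have h₃ : expTwist A B ∘ expMap = expMap ∘ Φ := funext hφΦ
    rw [h₃] at h₁
    have hinj : Function.Injective
        ((fderiv ℂ (expTwist A B) (expMap u)).comp (fderiv ℂ expMap u)) := by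
      rw [h₁.unique h₂]
      refine (injective_fderiv_expMap (Φ u)).comp ((injective_iff_map_eq_zero _).2 fun y hy => ?_)
      have hy' : y = -(fderiv ℂ h u y) := eq_neg_of_add_eq_zero_left hy
      have hle := (fderiv ℂ h u).le_of_opNorm_le (hhder u hx) y
      have : ‖y‖ = ‖fderiv ℂ h u y‖ := by rw [← norm_neg (fderiv ℂ h u y), ← hy']
      exact norm_le_zero_iff.1 (by linarith)
    have hsurj : Function.Surjective (fderiv ℂ expMap u) :=
      LinearMap.surjective_of_injective (f := (fderiv ℂ expMap u : ℂ × ℂ →ₗ[ℂ] ℂ × ℂ))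
        (injective_fderiv_expMap u)
    rw [ContinuousLinearMap.coe_comp] at hinj
    exact hinj.of_comp_right hsurj

end Biholomorphic

/-! ### The wedge in logarithmic coordinates and dominance of one monomial -/

section LogRegion

/-- The region `{|w| > e ^ ρ |z| ^ l, |z| > e ^ ((1 - κ l) ρ) |w| ^ κ}`. -/
def logRegion (l κ ρ : ℝ) : Set (ℂ × ℂ) :=
  {x | x.1 ≠ 0 ∧ x.2 ≠ 0 ∧ ρ < Real.log ‖x.2‖ - l * Real.log ‖x.1‖ ∧
    (1 - κ * l) * ρ < Real.log ‖x.1‖ - κ * Real.log ‖x.2‖}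

variable {l κ : ℝ}

theorem isOpen_logRegion (ρ : ℝ) : IsOpen (logRegion l κ ρ) := by
  rw [isOpen_iff_mem_nhds]
  rintro x ⟨h₁, h₂, h₃, h₄⟩
  have c₁ : ContinuousAt (fun y : ℂ × ℂ => Real.log ‖y.1‖) x :=
    continuousAt_fst.norm.log (norm_ne_zero_iff.2 h₁)
  have c₂ : ContinuousAt (fun y : ℂ × ℂ => Real.log ‖y.2‖) x :=
    continuousAt_snd.norm.log (norm_ne_zero_iff.2 h₂)
  filter_upwards [continuousAt_fst.eventually_ne h₁, continuousAt_snd.eventually_ne h₂,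
    continuousAt_const.eventually_lt (c₂.sub (continuousAt_const.mul c₁)) h₃,
    continuousAt_const.eventually_lt (c₁.sub (continuousAt_const.mul c₂)) h₄]
    with y g₁ g₂ g₃ g₄ using ⟨g₁, g₂, g₃, g₄⟩

theorem antitone_logRegion (h : κ * l < 1) : Antitone (logRegion l κ) := by
  rintro ρ ρ' hρ x ⟨h₁, h₂, h₃, h₄⟩
  exact ⟨h₁, h₂, hρ.trans_lt h₃,
    (mul_le_mul_of_nonneg_left hρ (by linarith)).trans_lt h₄⟩

theorem expMap_mem_logRegion {ρ : ℝ} {u : ℂ × ℂ} : expMap u ∈ logRegion l κ ρ ↔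
    ρ < u.2.re - l * u.1.re ∧ (1 - κ * l) * ρ < u.1.re - κ * u.2.re := by
  simp [logRegion, expMap, Complex.norm_exp]

theorem convex_preimage_logRegion (ρ : ℝ) : Convex ℝ (expMap ⁻¹' logRegion l κ ρ) := by
  intro u hu v hv s t hs ht hst
  rw [mem_preimage, expMap_mem_logRegion] at *
  obtain ⟨hu₁, hu₂⟩ := hu
  obtain ⟨hv₁, hv₂⟩ := hv
  have key : ∀ {a b c : ℝ}, c < a → c < b → c < s * a + t * b := fun {a b c} ha hb => by
    have := (convex_Ioi c) ha hb hs ht hst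
    simpa using this
  have k₁ := key hu₁ hv₁
  have k₂ := key hu₂ hv₂
  simp only [Prod.fst_add, Prod.snd_add, Prod.smul_fst, Prod.smul_snd, Complex.add_re,
    Complex.real_smul, Complex.mul_re, Complex.ofReal_re, Complex.ofReal_im, zero_mul, sub_zero]
  constructor <;> linarith

/-- A displacement r changes Y - lX by at most (1 + l)r and X - κY by at most (1 + κ)r; the radius
keeps both at most 1 - κl. This is the uniform room needed for Cauchy estimates. -/
theorem ball_subset_preimage_logRegion (hl : 0 ≤ l) (hκ : 0 ≤ κ) {ρ : ℝ}
    {u : ℂ × ℂ} (hu : u ∈ expMap ⁻¹' logRegion l κ ρ) :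
    ball u ((1 - κ * l) / (1 + l + κ)) ⊆ expMap ⁻¹' logRegion l κ (ρ - 1) := by
  intro v hv
  rw [mem_preimage, expMap_mem_logRegion] at *
  obtain ⟨hu₁, hu₂⟩ := hu
  have hr : dist v u * (1 + l + κ) < 1 - κ * l := by
    rwa [mem_ball, lt_div_iff₀ (by linarith)] at hv
  have h₁ : |v.1.re - u.1.re| ≤ dist v u := by
    rw [← Complex.sub_re]
    exact (Complex.abs_re_le_norm _).trans (norm_fst_le (v - u) |>.trans_eq (dist_eq_norm v u).symm)
  have h₂ : |v.2.re - u.2.re| ≤ dist v u := by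
    rw [← Complex.sub_re]
    exact (Complex.abs_re_le_norm _).trans (norm_snd_le (v - u) |>.trans_eq (dist_eq_norm v u).symm)
  obtain ⟨h₁l, h₁u⟩ := abs_le.1 h₁
  obtain ⟨h₂l, h₂u⟩ := abs_le.1 h₂
  have hd : 0 ≤ dist v u := dist_nonneg
  have e₁ := mul_le_mul_of_nonneg_left h₁u hl
  have e₂ := mul_le_mul_of_nonneg_left h₂u hκ
  have e₃ := mul_nonneg hd hl
  have e₄ := mul_nonneg hd hκ
  have e₅ := mul_nonneg hκ hl
  constructor <;> linarith

/-- Adding κ times the first inequality to the second eliminates Y and leaves (1 - κl)X. -/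
theorem le_log_norm_fst (hκ : 0 ≤ κ) (h : κ * l < 1) {ρ : ℝ} (hρ : 0 ≤ ρ) {X Y : ℝ}
    (hP : ρ < Y - l * X) (hQ : (1 - κ * l) * ρ < X - κ * Y) : ρ ≤ X := by
  have h₁ := mul_le_mul_of_nonneg_left hP.le hκ
  have h₂ : (1 - κ * l) * ρ ≤ (1 - κ * l) * X := by nlinarith [mul_nonneg hκ hρ]
  exact le_of_mul_le_mul_left h₂ (by linarith)

/-- On the region `logRegion l κ ρ`, a monomial `|z| ^ a |w| ^ b` whose exponent lies below both
supporting lines is small. -/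
theorem linear_le_of_mem_logRegion (h : κ * l < 1) {ρ a b X Y : ℝ}
    (hP : ρ < Y - l * X) (hQ : (1 - κ * l) * ρ < X - κ * Y) (hα : a + l * b ≤ 0)
    (hβ : κ * a + b ≤ 0) :
    a * X + b * Y ≤ ρ * ((a + l * b) + (κ * a + b) / (1 - κ * l)) := by
  have hD : 0 < 1 - κ * l := by linarith
  -- The identity behind this is (1 - κl)(aX + bY) = (a + lb)(X - κY) + (κa + b)(Y - lX).
  have h₁ := mul_le_mul_of_nonpos_left hQ.le hα
  have h₂ := mul_le_mul_of_nonpos_left hP.le hβ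
  have h₃ : (1 - κ * l) * (ρ * ((a + l * b) + (κ * a + b) / (1 - κ * l))) =
      (a + l * b) * ((1 - κ * l) * ρ) + (κ * a + b) * ρ := by
    field_simp
  refine le_of_mul_le_mul_left ?_ hD
  rw [h₃]
  linarith

theorem norm_monomial_eq_exp {z w : ℂ} (hz : z ≠ 0) (hw : w ≠ 0) (i j : ℕ) :
    ‖z ^ i * w ^ j‖ = Real.exp (i * Real.log ‖z‖ + j * Real.log ‖w‖) := by
  rw [Real.exp_add, Real.exp_nat_mul, Real.exp_nat_mul, Real.exp_log (norm_pos_iff.2 hz),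
    Real.exp_log (norm_pos_iff.2 hw), norm_mul, norm_pow, norm_pow]

/-- A polynomial is asymptotic to its dominant monomial. -/
theorem exists_norm_div_monomial_sub_one_le (h : κ * l < 1) {ι : Type*}
    (T : Finset ι) (c : ι → ℂ) (i j : ι → ℕ) {t₀ : ι} (ht₀ : t₀ ∈ T) (hc : c t₀ ≠ 0)
    (hα : ∀ t ∈ T, ((i t : ℝ) - i t₀) + l * ((j t : ℝ) - j t₀) ≤ 0)
    (hβ : ∀ t ∈ T, κ * ((i t : ℝ) - i t₀) + ((j t : ℝ) - j t₀) ≤ 0)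
    (hne : ∀ t ∈ T, t ≠ t₀ → i t ≠ i t₀ ∨ j t ≠ j t₀) :
    ∃ C e : ℝ, 0 < e ∧ ∀ ρ, 0 ≤ ρ → ∀ x ∈ logRegion l κ ρ,
      ‖(∑ t ∈ T, c t * (x.1 ^ i t * x.2 ^ j t)) / (c t₀ * (x.1 ^ i t₀ * x.2 ^ j t₀)) - 1‖ ≤
        C * Real.exp (-e * ρ) := by
  classical
  have hD : 0 < 1 - κ * l := by linarith
  set E : ι → ℝ := fun t => (((i t : ℝ) - i t₀) + l * ((j t : ℝ) - j t₀)) +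
    (κ * ((i t : ℝ) - i t₀) + ((j t : ℝ) - j t₀)) / (1 - κ * l) with hE
  -- Both summands are nonpositive. If both vanished, the two linear equations, of determinant 1 -
  -- κl ≠ 0, would make the exponents equal.
  have hEneg : ∀ t ∈ T.erase t₀, E t < 0 := by
    intro t ht
    have hb := hβ t (Finset.mem_of_mem_erase ht)
    have ha := hα t (Finset.mem_of_mem_erase ht)
    have hb' := div_nonpos_of_nonpos_of_nonneg hb hD.le
    refine lt_of_le_of_ne (by simp only [hE]; linarith) fun h0 => ?_
    simp only [hE] at h0
    have h1 : ((i t : ℝ) - i t₀) + l * ((j t : ℝ) - j t₀) = 0 := by linarith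
    have h2 : κ * ((i t : ℝ) - i t₀) + ((j t : ℝ) - j t₀) = 0 := by
      have : (κ * ((i t : ℝ) - i t₀) + ((j t : ℝ) - j t₀)) / (1 - κ * l) = 0 := by linarith
      exact (div_eq_zero_iff.1 this).resolve_right hD.ne'
    have h3 : (1 - κ * l) * ((i t : ℝ) - i t₀) = 0 := by linear_combination h1 - l * h2
    have h4 : (i t : ℝ) - i t₀ = 0 := (mul_eq_zero.1 h3).resolve_left hD.ne'
    rw [h4] at h2
    rcases hne t (Finset.mem_of_mem_erase ht) (Finset.ne_of_mem_erase ht) with h5 | h5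
    · exact h5 (by exact_mod_cast sub_eq_zero.1 h4)
    · exact h5 (by exact_mod_cast (by linarith : (j t : ℝ) = j t₀))
  obtain ⟨e, he, heE⟩ : ∃ e : ℝ, 0 < e ∧ ∀ t ∈ T.erase t₀, E t ≤ -e := by
    rcases (T.erase t₀).eq_empty_or_nonempty with h0 | h0
    · exact ⟨1, one_pos, by simp [h0]⟩
    · obtain ⟨t, ht, hmax⟩ := Finset.exists_max_image _ E h0
      exact ⟨-E t, by linarith [hEneg t ht], fun t' ht' => by linarith [hmax t' ht']⟩
  refine ⟨∑ t ∈ T.erase t₀, ‖c t / c t₀‖, e, he, ?_⟩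
  rintro ρ hρ x ⟨hz, hw, hP, hQ⟩
  have hm : c t₀ * (x.1 ^ i t₀ * x.2 ^ j t₀) ≠ 0 :=
    mul_ne_zero hc (mul_ne_zero (pow_ne_zero _ hz) (pow_ne_zero _ hw))
  rw [← Finset.add_sum_erase T _ ht₀, add_div, div_self hm, add_sub_cancel_left, Finset.sum_div,
    Finset.sum_mul]
  refine (norm_sum_le _ _).trans (Finset.sum_le_sum fun t ht => ?_)
  rw [mul_div_mul_comm, norm_mul, norm_div (x.1 ^ i t * x.2 ^ j t), norm_monomial_eq_exp hz hw,
    norm_monomial_eq_exp hz hw, ← Real.exp_sub]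
  refine mul_le_mul_of_nonneg_left (Real.exp_le_exp.2 ?_) (norm_nonneg _)
  have hlin := linear_le_of_mem_logRegion h hP hQ (hα t (Finset.mem_of_mem_erase ht))
    (hβ t (Finset.mem_of_mem_erase ht))
  have h5 := mul_le_mul_of_nonneg_left (heE t ht) hρ
  simp only [hE] at h5
  linarith

end LogRegion

/-! ### Construction of the conjugacy -/

section Asymptotic

theorem norm_log_le_of_norm_sub_one_le {u : ℂ} (hu : ‖u - 1‖ ≤ 1 / 2) :
    ‖Complex.log u‖ ≤ 3 / 2 * ‖u - 1‖ := by
  have := Complex.norm_log_one_add_half_le_self hu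
  rwa [add_sub_cancel] at this

theorem mem_slitPlane_of_norm_sub_one_le {u : ℂ} (hu : ‖u - 1‖ ≤ 1 / 2) :
    u ∈ Complex.slitPlane := by
  have := Complex.mem_slitPlane_of_norm_lt_one (z := u - 1) (by linarith)
  rwa [add_sub_cancel] at this

/-- If `F / m` is close to `1` then `log |F|` is close to `log |m|`. -/
theorem abs_log_norm_sub_le {F m : ℂ} (h : ‖F / m - 1‖ ≤ 1 / 2) :
    F ≠ 0 ∧ m ≠ 0 ∧ |Real.log ‖F‖ - Real.log ‖m‖| ≤ 1 := by
  have hne : F / m ≠ 0 := Complex.slitPlane_ne_zero (mem_slitPlane_of_norm_sub_one_le h)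
  have hF : F ≠ 0 := fun h0 => hne (by rw [h0, zero_div])
  have hm : m ≠ 0 := fun h0 => hne (by rw [h0, div_zero])
  refine ⟨hF, hm, ?_⟩
  rw [← Real.log_div (norm_ne_zero_iff.2 hF) (norm_ne_zero_iff.2 hm), ← norm_div,
    ← Complex.log_re]
  exact (Complex.abs_re_le_norm _).trans
    ((norm_log_le_of_norm_sub_one_le h).trans (by linarith))

theorem log_norm_monomial {c z w : ℂ} (hc : c ≠ 0) (hz : z ≠ 0) (hw : w ≠ 0) (i j : ℕ) :
    Real.log ‖c * (z ^ i * w ^ j)‖ =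
      Real.log ‖c‖ + (i * Real.log ‖z‖ + j * Real.log ‖w‖) := by
  rw [norm_mul, Real.log_mul (norm_ne_zero_iff.2 hc)
    (norm_ne_zero_iff.2 (mul_ne_zero (pow_ne_zero _ hz) (pow_ne_zero _ hw))),
    norm_monomial_eq_exp hz hw, Real.log_exp]

theorem eventually_mul_exp_le {e : ℝ} (he : 0 < e) (C : ℝ) {ε : ℝ} (hε : 0 < ε) :
    ∃ ρ₀ : ℝ, ∀ ρ, ρ₀ ≤ ρ → C * Real.exp (-e * ρ) ≤ ε := by
  have h : Tendsto (fun ρ : ℝ => C * Real.exp (-e * ρ)) atTop (𝓝 (C * 0)) := by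
    refine Tendsto.const_mul C (Real.tendsto_exp_atBot.comp ?_)
    exact tendsto_id.const_mul_atTop_of_neg (neg_lt_zero.2 he)
  rw [mul_zero] at h
  exact eventually_atTop.1 (h.eventually_le_const hε)

/-- A holomorphic map which is asymptotic to a monomial map on the regions `logRegion l κ ρ`, and
such that the monomial map moves these regions towards infinity, is conjugate to the monomial
map. -/
theorem exists_bottcher_coordinate {l κ : ℝ} (hl : 0 ≤ l) (hκ : 0 ≤ κ) (hκl : κ * l < 1)
    {f : ℂ × ℂ → ℂ × ℂ} (hf : Differentiable ℂ f) {a b : ℂ} (ha : a ≠ 0) (hb : b ≠ 0)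
    {δ γ d : ℕ} (hδ : 1 ≤ δ) (hd : 1 ≤ d) {C₁ e₁ C₂ e₂ c : ℝ} (he₁ : 0 < e₁) (he₂ : 0 < e₂)
    (hf₁ : ∀ ρ, 0 ≤ ρ → ∀ x ∈ logRegion l κ ρ,
      ‖(f x).1 / (a * (x.1 ^ δ * x.2 ^ 0)) - 1‖ ≤ C₁ * Real.exp (-e₁ * ρ))
    (hf₂ : ∀ ρ, 0 ≤ ρ → ∀ x ∈ logRegion l κ ρ,
      ‖(f x).2 / (b * (x.1 ^ γ * x.2 ^ d)) - 1‖ ≤ C₂ * Real.exp (-e₂ * ρ))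
    (hc : 0 < c)
    (hP : ∀ ρ X Y : ℝ, 0 ≤ ρ → ρ < Y - l * X → (1 - κ * l) * ρ < X - κ * Y →
      Y - l * X + c * ρ ≤ γ * X + d * Y - l * (δ * X))
    (hQ : ∀ ρ X Y : ℝ, 0 ≤ ρ → ρ < Y - l * X → (1 - κ * l) * ρ < X - κ * Y →
      X - κ * Y + c * ρ ≤ δ * X - κ * (γ * X + d * Y)) :
    ∃ (ρ₀ : ℝ) (φ : ℂ × ℂ → ℂ × ℂ),
      (∀ ρ, ρ₀ ≤ ρ → MapsTo f (logRegion l κ ρ) (logRegion l κ ρ) ∧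
        IsBiholomorphicOn φ (logRegion l κ ρ) ∧
        ∀ x ∈ logRegion l κ ρ, φ (f x) = monomialMap a b δ γ d (φ x)) ∧
      ∀ ε : ℝ, 0 < ε → ∃ ρ₁, ρ₀ ≤ ρ₁ ∧ ∀ ρ, ρ₁ ≤ ρ → ∀ x ∈ logRegion l κ ρ,
        ‖(φ x).1 - x.1‖ < ε * ‖x.1‖ ∧ ‖(φ x).2 - x.2‖ < ε * ‖x.2‖ := by
  obtain ⟨e, he, hee₁, hee₂⟩ : ∃ e : ℝ, 0 < e ∧ e ≤ e₁ ∧ e ≤ e₂ :=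
    ⟨min e₁ e₂, lt_min he₁ he₂, min_le_left _ _, min_le_right _ _⟩
  obtain ⟨C, hC, hCC₁, hCC₂⟩ : ∃ C : ℝ, 0 ≤ C ∧ C₁ ≤ C ∧ C₂ ≤ C :=
    ⟨max 0 (max C₁ C₂), le_max_left _ _, (le_max_left _ _).trans (le_max_right _ _),
      (le_max_right _ _).trans (le_max_right _ _)⟩
  have hmono : ∀ {C' e' ρ : ℝ}, C' ≤ C → e ≤ e' → 0 ≤ ρ →
      C' * Real.exp (-e' * ρ) ≤ C * Real.exp (-e * ρ) := fun hC' he' hρ =>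
    mul_le_mul hC' (Real.exp_le_exp.2 (by nlinarith)) (Real.exp_pos _).le hC
  obtain ⟨ρ₁, hρ₁⟩ := eventually_mul_exp_le he C (one_half_pos (α := ℝ))
  -- `K₁` and `K₂` bound the distance in log-modulus between `f` and the linear map (δX, γX + dY):
  -- the coefficient contributes its logarithm, the quotient near 1 at most 1. `ρ₀` is chosen so
  -- that the gain cρ absorbs these errors and still leaves 1.
  set K₁ : ℝ := |Real.log ‖a‖| + 1
  set K₂ : ℝ := |Real.log ‖b‖| + 1
  obtain ⟨ρ₀, hρ₀0, hρ₀1, hρ₀P, hρ₀Q⟩ : ∃ ρ₀ : ℝ, 0 ≤ ρ₀ ∧ ρ₁ ≤ ρ₀ ∧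
      K₂ + l * K₁ + 1 ≤ c * ρ₀ ∧ K₁ + κ * K₂ + 1 ≤ c * ρ₀ := by
    refine ⟨max (max 0 ρ₁) (max ((K₂ + l * K₁ + 1) / c) ((K₁ + κ * K₂ + 1) / c)),
      (le_max_left _ _).trans (le_max_left _ _), (le_max_right _ _).trans (le_max_left _ _), ?_, ?_⟩
    · rw [← div_le_iff₀' hc]
      exact (le_max_left _ _).trans (le_max_right _ _)
    · rw [← div_le_iff₀' hc]
      exact (le_max_right _ _).trans (le_max_right _ _)
  set V := logRegion l κ
  have hVo : ∀ ρ, IsOpen (V ρ) := isOpen_logRegion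
  have hanti : Antitone V := antitone_logRegion hκl
  set u₁ : ℂ × ℂ → ℂ := fun x => (f x).1 / (a * (x.1 ^ δ * x.2 ^ 0)) with hu₁
  set u₂ : ℂ × ℂ → ℂ := fun x => (f x).2 / (b * (x.1 ^ γ * x.2 ^ d)) with hu₂
  have hu₁C : ∀ ρ, ρ₀ ≤ ρ → ∀ x ∈ V ρ, ‖u₁ x - 1‖ ≤ C * Real.exp (-e * ρ) := fun ρ hρ x hx =>
    (hf₁ ρ (hρ₀0.trans hρ) x hx).trans (hmono hCC₁ hee₁ (hρ₀0.trans hρ))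
  have hu₂C : ∀ ρ, ρ₀ ≤ ρ → ∀ x ∈ V ρ, ‖u₂ x - 1‖ ≤ C * Real.exp (-e * ρ) := fun ρ hρ x hx =>
    (hf₂ ρ (hρ₀0.trans hρ) x hx).trans (hmono hCC₂ hee₂ (hρ₀0.trans hρ))
  have hu₁h : ∀ ρ, ρ₀ ≤ ρ → ∀ x ∈ V ρ, ‖u₁ x - 1‖ ≤ 1 / 2 := fun ρ hρ x hx =>
    (hu₁C ρ hρ x hx).trans (hρ₁ ρ (hρ₀1.trans hρ))
  have hu₂h : ∀ ρ, ρ₀ ≤ ρ → ∀ x ∈ V ρ, ‖u₂ x - 1‖ ≤ 1 / 2 := fun ρ hρ x hx =>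
    (hu₂C ρ hρ x hx).trans (hρ₁ ρ (hρ₀1.trans hρ))
  have hmaps : ∀ ρ, ρ₀ ≤ ρ → MapsTo f (V ρ) (V (ρ + 1)) := by
    intro ρ hρ x hx
    obtain ⟨hz, hw, hPx, hQx⟩ := id hx
    obtain ⟨hF₁, -, h₁⟩ := abs_log_norm_sub_le (hu₁h ρ hρ x hx)
    obtain ⟨hF₂, -, h₂⟩ := abs_log_norm_sub_le (hu₂h ρ hρ x hx)
    rw [log_norm_monomial ha hz hw, Nat.cast_zero, zero_mul, add_zero] at h₁
    rw [log_norm_monomial hb hz hw] at h₂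
    have hPρ := hP ρ _ _ (hρ₀0.trans hρ) hPx hQx
    have hQρ := hQ ρ _ _ (hρ₀0.trans hρ) hPx hQx
    have hcρ := mul_le_mul_of_nonneg_left hρ hc.le
    have g₁ : |Real.log ‖(f x).1‖ - δ * Real.log ‖x.1‖| ≤ K₁ := by
      have := abs_add_le (Real.log ‖(f x).1‖ - (Real.log ‖a‖ + δ * Real.log ‖x.1‖)) (Real.log ‖a‖)
      rw [show Real.log ‖(f x).1‖ - (Real.log ‖a‖ + δ * Real.log ‖x.1‖) + Real.log ‖a‖ =
        Real.log ‖(f x).1‖ - δ * Real.log ‖x.1‖ by ring] at this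
      simp only [K₁]
      linarith
    have g₂ : |Real.log ‖(f x).2‖ - (γ * Real.log ‖x.1‖ + d * Real.log ‖x.2‖)| ≤ K₂ := by
      have := abs_add_le (Real.log ‖(f x).2‖ -
        (Real.log ‖b‖ + (γ * Real.log ‖x.1‖ + d * Real.log ‖x.2‖))) (Real.log ‖b‖)
      rw [show Real.log ‖(f x).2‖ - (Real.log ‖b‖ + (γ * Real.log ‖x.1‖ + d * Real.log ‖x.2‖)) +
        Real.log ‖b‖ = Real.log ‖(f x).2‖ - (γ * Real.log ‖x.1‖ + d * Real.log ‖x.2‖) by ring]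
        at this
      simp only [K₂]
      linarith
    obtain ⟨g₁l, g₁u⟩ := abs_le.1 g₁
    obtain ⟨g₂l, g₂u⟩ := abs_le.1 g₂
    have t₁ := mul_le_mul_of_nonneg_left g₁u hl
    have t₂ := mul_le_mul_of_nonneg_left g₂u hκ
    have t₃ := mul_nonneg hκ hl
    exact ⟨hF₁, hF₂, by linarith, by linarith⟩
  have hdiff : ∀ (c' : ℂ), c' ≠ 0 → ∀ i j : ℕ, ∀ F : ℂ × ℂ → ℂ, Differentiable ℂ F →
      (∀ x ∈ V ρ₀, ‖F x / (c' * (x.1 ^ i * x.2 ^ j)) - 1‖ ≤ 1 / 2) →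
      DifferentiableOn ℂ (fun x => Complex.log (F x / (c' * (x.1 ^ i * x.2 ^ j)))) (V ρ₀) := by
    intro c' hc' i j F hF hFh
    have hm : Differentiable ℂ fun x : ℂ × ℂ => c' * (x.1 ^ i * x.2 ^ j) := by fun_prop
    have hm₀ : ∀ x ∈ V ρ₀, c' * (x.1 ^ i * x.2 ^ j) ≠ 0 := fun x hx =>
      mul_ne_zero hc' (mul_ne_zero (pow_ne_zero _ hx.1) (pow_ne_zero _ hx.2.1))
    have hq : DifferentiableOn ℂ (fun x => F x / (c' * (x.1 ^ i * x.2 ^ j))) (V ρ₀) := by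
      simp only [div_eq_mul_inv]
      exact hF.differentiableOn.mul (hm.differentiableOn.fun_inv hm₀)
    exact hq.clog fun x hx =>
      mem_slitPlane_of_norm_sub_one_le (hFh x hx)
  have hδ0 : (δ : ℂ) ≠ 0 := by exact_mod_cast (by omega : δ ≠ 0)
  have hd0 : (d : ℂ) ≠ 0 := by exact_mod_cast (by omega : d ≠ 0)
  obtain ⟨A, CA, hAd, hAC, hAf⟩ := exists_cohomological_solution (U := V) (f := f)
    (g := fun x => Complex.log (u₁ x)) (a := (δ : ℂ)⁻¹) (ρ₀ := ρ₀) (c := e) (C := 3 / 2 * C)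
    hVo hmaps hanti hf (hdiff a ha δ 0 _ hf.fst (hu₁h ρ₀ le_rfl)) he
    (fun ρ hρ x hx => (norm_log_le_of_norm_sub_one_le (hu₁h ρ hρ x hx)).trans
      (by linarith [hu₁C ρ hρ x hx]))
    (by rw [norm_inv, Complex.norm_natCast]; exact inv_le_one_of_one_le₀ (by exact_mod_cast hδ))
  -- The system is triangular: `A` is already known and decays at rate `e`, so it joins the
  -- inhomogeneous term.
  obtain ⟨B, CB, hBd, hBC, hBf⟩ := exists_cohomological_solution (U := V) (f := f)
    (g := fun x => Complex.log (u₂ x) - γ * A x) (a := (d : ℂ)⁻¹) (ρ₀ := ρ₀) (c := e)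
    (C := 3 / 2 * C + γ * CA)
    hVo hmaps hanti hf ((hdiff b hb γ d _ hf.snd (hu₂h ρ₀ le_rfl)).sub (hAd.const_mul _)) he
    (fun ρ hρ x hx => by
      refine (norm_sub_le _ _).trans ?_
      rw [norm_mul, Complex.norm_natCast, add_mul]
      refine add_le_add ((norm_log_le_of_norm_sub_one_le (hu₂h ρ hρ x hx)).trans
        (by linarith [hu₂C ρ hρ x hx])) ?_
      rw [mul_assoc]
      exact mul_le_mul_of_nonneg_left (hAC ρ hρ x hx) (Nat.cast_nonneg γ))
    (by rw [norm_inv, Complex.norm_natCast]; exact inv_le_one_of_one_le₀ (by exact_mod_cast hd))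
  have hsmall : ∀ ε : ℝ, 0 < ε → ∃ ρ', ρ₀ ≤ ρ' ∧ ∀ ρ, ρ' ≤ ρ → ∀ x ∈ V ρ,
      ‖A x‖ ≤ ε ∧ ‖B x‖ ≤ ε := by
    intro ε hε
    obtain ⟨ρA, hA⟩ := eventually_mul_exp_le he CA hε
    obtain ⟨ρB, hB⟩ := eventually_mul_exp_le he CB hε
    refine ⟨max ρ₀ (max ρA ρB), le_max_left _ _, fun ρ hρ x hx => ?_⟩
    simp only [max_le_iff] at hρ
    exact ⟨(hAC ρ hρ.1 x hx).trans (hA ρ hρ.2.1), (hBC ρ hρ.1 x hx).trans (hB ρ hρ.2.2)⟩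
  set r : ℝ := (1 - κ * l) / (1 + l + κ)
  have hr : 0 < r := div_pos (by linarith) (by linarith)
  -- The bound r/4 makes the Cauchy estimate 2(r/4)/r = 1/2. It must hold one level below the final
  -- domain, hence `ρ₂ + 1` next.
  obtain ⟨ρ₂, hρ₂, hρ₂s⟩ := hsmall (r / 4) (by linarith)
  refine ⟨ρ₂ + 1, expTwist A B, fun ρ hρ => ⟨?_, ?_, ?_⟩, ?_⟩
  · exact (hmaps ρ (by linarith)).mono_right (hanti (by linarith))
  · have hsub : V (ρ - 1) ⊆ V ρ₀ := hanti (by linarith)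
    refine isBiholomorphicOn_expTwist (r := r) (M := r / 4) (hVo ρ) (fun x hx => ⟨hx.1, hx.2.1⟩)
      (convex_preimage_logRegion ρ) hr (fun u hu => ball_subset_preimage_logRegion hl hκ hu)
      (hAd.mono hsub) (hBd.mono hsub) (fun x hx => (hρ₂s (ρ - 1) (by linarith) x hx).1)
      (fun x hx => (hρ₂s (ρ - 1) (by linarith) x hx).2) ?_
    rw [div_le_iff₀ hr]
    linarith
  · intro x hx
    have hρ₀ρ : ρ₀ ≤ ρ := by linarith
    have hx₀ : x ∈ V ρ₀ := hanti hρ₀ρ hx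
    obtain ⟨hF₁, hm₁, -⟩ := abs_log_norm_sub_le (hu₁h ρ hρ₀ρ x hx)
    obtain ⟨hF₂, hm₂, -⟩ := abs_log_norm_sub_le (hu₂h ρ hρ₀ρ x hx)
    have hA' : A (f x) = δ * A x - Complex.log (u₁ x) := by
      rw [hAf x hx₀, mul_inv_cancel_left₀ hδ0]
      ring
    have hB' : B (f x) = d * B x + γ * A x - Complex.log (u₂ x) := by
      rw [hBf x hx₀, mul_inv_cancel_left₀ hd0]
      ring
    have hE₁ : (f x).1 * Complex.exp (A (f x)) = a * (x.1 * Complex.exp (A x)) ^ δ := by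
      rw [hA', Complex.exp_sub, Complex.exp_log (div_ne_zero hF₁ hm₁), Complex.exp_nat_mul]
      simp only [pow_zero, mul_one, mul_pow]
      field_simp
    have hE₂ : (f x).2 * Complex.exp (B (f x)) =
        b * (x.1 * Complex.exp (A x)) ^ γ * (x.2 * Complex.exp (B x)) ^ d := by
      rw [hB', Complex.exp_sub, Complex.exp_log (div_ne_zero hF₂ hm₂), Complex.exp_add,
        Complex.exp_nat_mul, Complex.exp_nat_mul]
      rw [mul_pow, mul_pow]
      field_simp
    exact Prod.ext hE₁ hE₂
  · intro ε hε
    -- For |t| ≤ 1 one has |exp t - 1| ≤ 2|t|, here at most ε/2, which leaves the strict inequality.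
    obtain ⟨ρ₃, -, hρ₃s⟩ := hsmall (min 1 (ε / 4)) (lt_min one_pos (by linarith))
    refine ⟨max (ρ₂ + 1) ρ₃, le_max_left _ _, fun ρ hρ x hx => ?_⟩
    have hexp : ∀ {y t : ℂ}, y ≠ 0 → ‖t‖ ≤ min 1 (ε / 4) →
        ‖y * Complex.exp t - y‖ < ε * ‖y‖ := by
      intro y t hy ht
      have h₁ := Complex.norm_exp_sub_one_le (ht.trans (min_le_left _ _))
      have h₂ := ht.trans (min_le_right _ _)
      rw [show y * Complex.exp t - y = (Complex.exp t - 1) * y by ring, norm_mul]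
      exact mul_lt_mul_of_pos_right (by linarith) (norm_pos_iff.2 hy)
    have hs := hρ₃s ρ ((le_max_right _ _).trans hρ) x hx
    exact ⟨hexp hx.1 hs.1, hexp hx.2.1 hs.2⟩

end Asymptotic

/-! ### Convex geometry of the Newton polygon -/

section NewtonPolygon

variable {q : MvPolynomial (Fin 2) ℂ}

theorem finsupp_fin_two_eq (t : Fin 2 →₀ ℕ) :
    Finsupp.single 0 (t 0) + Finsupp.single 1 (t 1) = t := by
  ext i
  fin_cases i <;> simp

theorem bCoeff_ne_zero_of_mem_support {t : Fin 2 →₀ ℕ} (ht : t ∈ q.support) :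
    bCoeff q (t 0) (t 1) ≠ 0 := by
  rwa [bCoeff, finsupp_fin_two_eq, ← MvPolynomial.mem_support_iff]

theorem mem_newtonPolygon {i j : ℕ} (h : bCoeff q i j ≠ 0) : ((i : ℝ), (j : ℝ)) ∈ newtonPolygon q :=
  subset_convexHull ℝ _ ⟨i, j, h, le_rfl, le_rfl⟩

theorem newtonPolygon_subset {H : Set (ℝ × ℝ)} (hH : Convex ℝ H) (hlow : IsLowerSet H)
    (h : ∀ i j : ℕ, bCoeff q i j ≠ 0 → ((i : ℝ), (j : ℝ)) ∈ H) : newtonPolygon q ⊆ H := by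
  refine convexHull_min ?_ hH
  rintro x ⟨i, j, hij, hx⟩
  exact hlow (Prod.mk_le_mk.2 hx) (h i j hij)

/-- Translation by x - y ≤ 0 maps each generating quadrant into itself, hence also the convex hull.
-/
theorem isLowerSet_newtonPolygon : IsLowerSet (newtonPolygon q) := by
  intro y x hxy hy
  have hsub : newtonPolygon q ⊆ (fun z => (x - y) + z) ⁻¹' newtonPolygon q := by
    refine convexHull_min ?_ ((convex_convexHull ℝ _).translate_preimage_right (x - y))
    rintro z ⟨i, j, hij, hz₁, hz₂⟩
    refine subset_convexHull ℝ _ ⟨i, j, hij, ?_, ?_⟩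
    · have : x.1 ≤ y.1 := hxy.1
      simp only [Prod.fst_add, Prod.fst_sub]
      linarith
    · have : x.2 ≤ y.2 := hxy.2
      simp only [Prod.snd_add, Prod.snd_sub]
      linarith
  have := hsub hy
  rwa [mem_preimage, sub_add_cancel] at this

/-- An extreme point lies in some generating quadrant. It is the midpoint of the corner and of the
corner's reflection, which is still in the polygon, so it equals the corner. -/
theorem exists_bCoeff_ne_zero_of_mem_extremePoints {v : ℝ × ℝ}
    (hv : v ∈ (newtonPolygon q).extremePoints ℝ) :
    ∃ i j : ℕ, bCoeff q i j ≠ 0 ∧ v = ((i : ℝ), (j : ℝ)) := by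
  obtain ⟨i, j, hij, h₁, h₂⟩ := extremePoints_convexHull_subset hv
  refine ⟨i, j, hij, ?_⟩
  have hp := mem_newtonPolygon hij
  have hr : v + (v - ((i : ℝ), (j : ℝ))) ∈ newtonPolygon q := by
    refine isLowerSet_newtonPolygon (Prod.mk_le_mk.2 ⟨?_, ?_⟩) hp
    · simp only [Prod.fst_sub]
      linarith
    · simp only [Prod.snd_sub]
      linarith
  refine ((mem_extremePoints.1 hv).2 _ hp _ hr ⟨1 / 2, 1 / 2, by norm_num, by norm_num,
    by norm_num, ?_⟩).1.symm
  ext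
  · simp
    ring
  · simp
    ring

/-- A linear functional with positive coefficients is maximized over the exponents of `q` at a
vertex of the Newton polygon. -/
theorem exists_extremePoint_forall_le (hq : q ≠ 0) {s t : ℝ} (hs : 0 < s) (ht : 0 < t) :
    ∃ v ∈ (newtonPolygon q).extremePoints ℝ,
      ∀ i j : ℕ, bCoeff q i j ≠ 0 → s * i + t * j ≤ s * v.1 + t * v.2 := by
  -- The functional may be constant along an edge, so ties are broken by the first exponent. The
  -- lexicographic half-plane `H` below the maximizer is convex and a lower set, so it contains the
  -- polygon, and this makes the maximizer extreme.
  obtain ⟨e, he, hmax⟩ := Finset.exists_max_image q.support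
    (fun e => toLex (s * (e 0 : ℝ) + t * (e 1 : ℝ), (e 0 : ℝ)))
    (Finset.nonempty_iff_ne_empty.2 (by rwa [Ne, MvPolynomial.support_eq_empty]))
  set v : ℝ × ℝ := ((e 0 : ℝ), (e 1 : ℝ)) with hv
  set H : Set (ℝ × ℝ) := {y | s * y.1 + t * y.2 < s * v.1 + t * v.2 ∨
    (s * y.1 + t * y.2 = s * v.1 + t * v.2 ∧ y.1 ≤ v.1)} with hHdef
  have hS : ∀ i j : ℕ, bCoeff q i j ≠ 0 → ((i : ℝ), (j : ℝ)) ∈ H := by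
    intro i j hij
    have := hmax _ (MvPolynomial.mem_support_iff.2 hij)
    simpa [Prod.Lex.toLex_le_toLex, hHdef, hv] using this
  have hH : Convex ℝ H := by
    refine convex_iff_forall_pos.2 fun y hy z hz a b ha hb hab => ?_
    have hle : ∀ {y}, y ∈ H → s * y.1 + t * y.2 ≤ s * v.1 + t * v.2 := fun hy =>
      hy.elim le_of_lt fun h => h.1.le
    have hM : a * (s * v.1 + t * v.2) + b * (s * v.1 + t * v.2) = s * v.1 + t * v.2 := by
      rw [← add_mul, hab, one_mul]
    have e₁ : s * (a • y + b • z).1 + t * (a • y + b • z).2 =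
        a * (s * y.1 + t * y.2) + b * (s * z.1 + t * z.2) := by
      simp only [Prod.fst_add, Prod.snd_add, Prod.smul_fst, Prod.smul_snd, smul_eq_mul]
      ring
    have hya := mul_le_mul_of_nonneg_left (hle hy) ha.le
    have hzb := mul_le_mul_of_nonneg_left (hle hz) hb.le
    simp only [hHdef, mem_ofPred_eq, e₁]
    rcases hy with hy | hy
    · left
      have := mul_lt_mul_of_pos_left hy ha
      linarith
    rcases hz with hz | hz
    · left
      have := mul_lt_mul_of_pos_left hz hb
      linarith
    right
    refine ⟨by rw [hy.1, hz.1, hM], ?_⟩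
    have h₁ := mul_le_mul_of_nonneg_left hy.2 ha.le
    have h₂ := mul_le_mul_of_nonneg_left hz.2 hb.le
    have h₃ : a * v.1 + b * v.1 = v.1 := by rw [← add_mul, hab, one_mul]
    simp only [Prod.fst_add, Prod.smul_fst, smul_eq_mul]
    linarith
  have hlow : IsLowerSet H := by
    intro y x hxy hy
    have h₁ := mul_le_mul_of_nonneg_left hxy.1 hs.le
    have h₂ := mul_le_mul_of_nonneg_left hxy.2 ht.le
    rcases hy with hy | hy
    · exact Or.inl (by linarith)
    · rcases (show s * x.1 + t * x.2 ≤ s * v.1 + t * v.2 by linarith).lt_or_eq with h | h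
      · exact Or.inl h
      · exact Or.inr ⟨h, hxy.1.trans hy.2⟩
  have hNH := newtonPolygon_subset hH hlow hS
  refine ⟨v, mem_extremePoints.2 ⟨mem_newtonPolygon (bCoeff_ne_zero_of_mem_support he), ?_⟩,
    fun i j hij => (hS i j hij).elim le_of_lt fun h => h.1.le⟩
  rintro y hy z hz ⟨a, b, ha, hb, hab, hyz⟩
  have hle : ∀ {y}, y ∈ H → s * y.1 + t * y.2 ≤ s * v.1 + t * v.2 := fun hy =>
    hy.elim le_of_lt fun h => h.1.le
  have f₁ : a * y.1 + b * z.1 = v.1 := congrArg Prod.fst hyz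
  have f₂ : a * y.2 + b * z.2 = v.2 := congrArg Prod.snd hyz
  have hb' : b = 1 - a := by linarith
  have tight : ∀ {A B M : ℝ}, A ≤ M → B ≤ M → a * A + b * B = M → A = M ∧ B = M := by
    intro A B M hA hB h
    subst hb'
    constructor <;> nlinarith
  have hℓ : s * y.1 + t * y.2 = s * v.1 + t * v.2 ∧ s * z.1 + t * z.2 = s * v.1 + t * v.2 :=
    tight (hle (hNH hy)) (hle (hNH hz)) (by rw [← f₁, ← f₂]; ring)
  have hx : y.1 = v.1 ∧ z.1 = v.1 :=
    tight ((hNH hy).resolve_left hℓ.1.not_lt).2 ((hNH hz).resolve_left hℓ.2.not_lt).2 f₁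
  constructor
  · refine Prod.ext hx.1 (mul_left_cancel₀ ht.ne' ?_)
    have := hℓ.1
    rw [hx.1] at this
    linarith
  · refine Prod.ext hx.2 (mul_left_cancel₀ ht.ne' ?_)
    have := hℓ.2
    rw [hx.2] at this
    linarith

/-- A vertex of the Newton polygon lies strictly above every chord that passes over it. -/
theorem lt_of_mem_extremePoints {v a b : ℝ × ℝ} (hv : v ∈ (newtonPolygon q).extremePoints ℝ)
    (ha : a ∈ newtonPolygon q) (hb : b ∈ newtonPolygon q) (hav : a.1 < v.1) (hvb : v.1 < b.1) :
    (b.1 - v.1) * a.2 + (v.1 - a.1) * b.2 < (b.1 - a.1) * v.2 := by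
  by_contra! hle
  have hD : 0 < b.1 - a.1 := by linarith
  set s := (b.1 - v.1) / (b.1 - a.1) with hs
  set t := (v.1 - a.1) / (b.1 - a.1) with ht
  have hst : s + t = 1 := by
    rw [hs, ht, ← add_div, div_eq_one_iff_eq hD.ne']
    ring
  have hle' : v.2 ≤ s * a.2 + t * b.2 := by
    rw [hs, ht, div_mul_eq_mul_div, div_mul_eq_mul_div, ← add_div, le_div_iff₀ hD]
    linarith
  -- Lowering both endpoints by the excess `h` stays in the polygon and puts `v` inside the segment,
  -- contradicting extremality.
  set h := s * a.2 + t * b.2 - v.2 with hh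
  have ha' : (a.1, a.2 - h) ∈ newtonPolygon q :=
    isLowerSet_newtonPolygon (Prod.mk_le_mk.2 ⟨le_rfl, by linarith⟩) ha
  have hb' : (b.1, b.2 - h) ∈ newtonPolygon q :=
    isLowerSet_newtonPolygon (Prod.mk_le_mk.2 ⟨le_rfl, by linarith⟩) hb
  have hseg : v ∈ openSegment ℝ (a.1, a.2 - h) (b.1, b.2 - h) := by
    refine ⟨s, t, div_pos (by linarith) hD, div_pos (by linarith) hD, hst, Prod.ext ?_ ?_⟩
    · simp only [Prod.fst_add, Prod.smul_fst, smul_eq_mul, hs, ht]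
      field_simp
      ring
    · simp only [Prod.snd_add, Prod.smul_snd, smul_eq_mul]
      linear_combination (-h) * hst + hh
  have := congrArg Prod.fst ((mem_extremePoints.1 hv).2 _ ha' _ hb' hseg).1
  exact hav.ne this

namespace IsVertexList

variable {s : ℕ} {n m : ℕ → ℕ}

theorem mem_extremePoints (hv : IsVertexList q s n m) {k : ℕ} (hk : k ∈ Icc 1 s) :
    ((n k : ℝ), (m k : ℝ)) ∈ (newtonPolygon q).extremePoints ℝ := by
  rw [← hv.vertices]
  exact ⟨k, hk, rfl⟩

theorem mem_newtonPolygon (hv : IsVertexList q s n m) {k : ℕ} (hk : k ∈ Icc 1 s) :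
    ((n k : ℝ), (m k : ℝ)) ∈ newtonPolygon q :=
  extremePoints_subset (hv.mem_extremePoints hk)

theorem bCoeff_ne_zero (hv : IsVertexList q s n m) {k : ℕ} (hk : k ∈ Icc 1 s) :
    bCoeff q (n k) (m k) ≠ 0 := by
  obtain ⟨i, j, hij, h⟩ := exists_bCoeff_ne_zero_of_mem_extremePoints (hv.mem_extremePoints hk)
  rw [Prod.mk.injEq, Nat.cast_inj, Nat.cast_inj] at h
  rwa [h.1, h.2]

theorem n_lt (hv : IsVertexList q s n m) {j k : ℕ} (hj : 1 ≤ j) (hjk : j < k) (hk : k ≤ s) :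
    (n j : ℝ) < n k :=
  Nat.cast_lt.2 (hv.strictMonoOn ⟨hj, hjk.le.trans hk⟩ ⟨hj.trans hjk.le, hk⟩ hjk)

theorem m_lt (hv : IsVertexList q s n m) {j k : ℕ} (hj : 1 ≤ j) (hjk : j < k) (hk : k ≤ s) :
    (m k : ℝ) < m j :=
  Nat.cast_lt.2 (hv.strictAntiOn ⟨hj, hjk.le.trans hk⟩ ⟨hj.trans hjk.le, hk⟩ hjk)

theorem n_lt_strictly_above (hv : IsVertexList q s n m) {i j k : ℕ} (hi : 1 ≤ i) (hij : i < j)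
    (hjk : j < k) (hk : k ≤ s) :
    ((n k : ℝ) - n j) * m i + ((n j : ℝ) - n i) * m k < ((n k : ℝ) - n i) * m j :=
  lt_of_mem_extremePoints (hv.mem_extremePoints ⟨by omega, by omega⟩)
    (hv.mem_newtonPolygon ⟨by omega, by omega⟩) (hv.mem_newtonPolygon ⟨by omega, by omega⟩)
    (hv.n_lt hi hij (by omega)) (hv.n_lt (by omega) hjk hk)

theorem edgeWeight_pos (hv : IsVertexList q s n m) {k : ℕ} (hk : 1 ≤ k) (hks : k + 1 ≤ s) :
    0 < edgeWeight n m k :=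
  div_pos (sub_pos.2 (hv.n_lt hk k.lt_succ_self hks)) (sub_pos.2 (hv.m_lt hk k.lt_succ_self hks))

theorem edgeWeight_mul (hv : IsVertexList q s n m) {k : ℕ} (hk : 1 ≤ k) (hks : k + 1 ≤ s) :
    edgeWeight n m k * ((m k : ℝ) - m (k + 1)) = (n (k + 1) : ℝ) - n k :=
  div_mul_cancel₀ _ (sub_pos.2 (hv.m_lt hk k.lt_succ_self hks)).ne'

/-- Strict concavity at the middle vertex. In the fourth case this gives l₂ > 0 and κl₁ < 1. -/
theorem edgeWeight_succ_lt (hv : IsVertexList q s n m) {k : ℕ} (hk : 1 ≤ k) (hks : k + 2 ≤ s) :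
    edgeWeight n m (k + 1) < edgeWeight n m k := by
  have h := hv.n_lt_strictly_above hk k.lt_succ_self (k + 1).lt_succ_self hks
  have h₁ := hv.m_lt hk k.lt_succ_self (by omega)
  have h₂ := hv.m_lt (by omega) (k + 1).lt_succ_self hks
  rw [edgeWeight, edgeWeight, div_lt_div_iff₀ (sub_pos.2 h₂) (sub_pos.2 h₁)]
  linarith

theorem mul_yIntercept (hv : IsVertexList q s n m) {k : ℕ} (hk : 1 ≤ k) (hks : k + 1 ≤ s) :
    edgeWeight n m k * yIntercept n m k = n k + edgeWeight n m k * m k := by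
  have h₁ := (sub_pos.2 (hv.n_lt hk k.lt_succ_self hks)).ne'
  have h₂ := (sub_pos.2 (hv.m_lt hk k.lt_succ_self hks)).ne'
  rw [yIntercept, edgeWeight]
  field_simp
  ring

theorem edge_line (hv : IsVertexList q s n m) {k : ℕ} (hk : 1 ≤ k) (hks : k + 1 ≤ s) :
    n (k + 1) + edgeWeight n m k * m (k + 1) = n k + edgeWeight n m k * m k := by
  linarith [hv.edgeWeight_mul hk hks]

theorem exists_vertex_forall_le (hv : IsVertexList q s n m) (hq : q ≠ 0) {a b : ℝ} (ha : 0 < a)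
    (hb : 0 < b) : ∃ k ∈ Icc 1 s, ∀ i j : ℕ, bCoeff q i j ≠ 0 → a * i + b * j ≤ a * n k + b * m k := by
  obtain ⟨v, hvN, h⟩ := exists_extremePoint_forall_le hq ha hb
  rw [← hv.vertices] at hvN
  obtain ⟨k, hk, rfl⟩ := hvN
  exact ⟨k, hk, h⟩

/-- The exponents of `q` lie below the lines through the edges of the Newton polygon. -/
theorem le_edge (hv : IsVertexList q s n m) (hq : q ≠ 0) {k : ℕ} (hk : 1 ≤ k) (hks : k + 1 ≤ s)
    {i j : ℕ} (hij : bCoeff q i j ≠ 0) :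
    i + edgeWeight n m k * j ≤ n k + edgeWeight n m k * m k := by
  obtain ⟨r, ⟨hr₁, hrs⟩, hr⟩ := hv.exists_vertex_forall_le hq one_pos (hv.edgeWeight_pos hk hks)
  have hline := hv.edgeWeight_mul hk hks
  have hm := sub_pos.2 (hv.m_lt hk k.lt_succ_self hks)
  have hrij := hr i j hij
  rw [one_mul, one_mul] at hrij
  refine hrij.trans ?_
  -- Only a maximizing vertex needs checking. If it is not an end of the edge, concavity at the
  -- nearer end puts it below the edge line.
  rcases lt_trichotomy r k with h | rfl | h
  · have := hv.n_lt_strictly_above hr₁ h k.lt_succ_self hks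
    refine le_of_mul_le_mul_left ?_ hm
    rw [Nat.succ_eq_add_one] at *
    have e : (edgeWeight n m k * ((m k : ℝ) - m (k + 1)) - ((n (k + 1) : ℝ) - n k)) *
        ((m r : ℝ) - m k) = 0 := by rw [hline, sub_self, zero_mul]
    linarith
  · exact le_rfl
  · rcases (Nat.succ_le_of_lt h).eq_or_lt with rfl | h
    · exact (hv.edge_line hk hks).le
    · have := hv.n_lt_strictly_above hk k.lt_succ_self h hrs
      refine le_of_mul_le_mul_left ?_ hm
      rw [Nat.succ_eq_add_one] at *
      have e : (edgeWeight n m k * ((m k : ℝ) - m (k + 1)) - ((n (k + 1) : ℝ) - n k)) *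
          ((m r : ℝ) - m k) = 0 := by rw [hline, sub_self, zero_mul]
      linarith

/-- The horizontal functional has no positive second weight, so it is perturbed by 1/(m₁ + 1). The
perturbation is below 1 at every vertex, and integrality removes it. -/
theorem le_n_last (hv : IsVertexList q s n m) (hq : q ≠ 0) {i j : ℕ} (hij : bCoeff q i j ≠ 0) :
    i ≤ n s := by
  have hM : (0 : ℝ) < m 1 + 1 := by positivity
  obtain ⟨k, hk, h⟩ := hv.exists_vertex_forall_le hq one_pos (inv_pos.2 hM)
  have h₁ := h i j hij
  have hs : 1 ≤ s := hk.1.trans hk.2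
  have h₂ : (n k : ℝ) ≤ n s :=
    Nat.cast_le.2 (hv.strictMonoOn.monotoneOn hk ⟨hs, le_rfl⟩ hk.2)
  have h₃ : (m k : ℝ) ≤ m 1 :=
    Nat.cast_le.2 (hv.strictAntiOn.antitoneOn ⟨le_rfl, hs⟩ hk hk.1)
  have h₄ : ((m 1 : ℝ) + 1)⁻¹ * m k < 1 := by
    rw [inv_mul_lt_iff₀ hM]
    linarith
  have h₅ : 0 ≤ ((m 1 : ℝ) + 1)⁻¹ * j := by positivity
  have : (i : ℝ) < (n s + 1 : ℕ) := by
    push_cast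
    linarith
  exact Nat.lt_succ_iff.1 (Nat.cast_lt.1 this)

theorem le_m_first (hv : IsVertexList q s n m) (hq : q ≠ 0) {i j : ℕ} (hij : bCoeff q i j ≠ 0) :
    j ≤ m 1 := by
  have hM : (0 : ℝ) < n s + 1 := by positivity
  obtain ⟨k, hk, h⟩ := hv.exists_vertex_forall_le hq (inv_pos.2 hM) one_pos
  have h₁ := h i j hij
  have hs : 1 ≤ s := hk.1.trans hk.2
  have h₂ : (n k : ℝ) ≤ n s :=
    Nat.cast_le.2 (hv.strictMonoOn.monotoneOn hk ⟨hs, le_rfl⟩ hk.2)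
  have h₃ : (m k : ℝ) ≤ m 1 :=
    Nat.cast_le.2 (hv.strictAntiOn.antitoneOn ⟨le_rfl, hs⟩ hk hk.1)
  have h₄ : ((n s : ℝ) + 1)⁻¹ * n k < 1 := by
    rw [inv_mul_lt_iff₀ hM]
    linarith
  have h₅ : 0 ≤ ((n s : ℝ) + 1)⁻¹ * i := by positivity
  have : (j : ℝ) < (m 1 + 1 : ℕ) := by
    push_cast
    linarith
  exact Nat.lt_succ_iff.1 (Nat.cast_lt.1 this)

end IsVertexList

end NewtonPolygon

/-! ### The regions as logarithmic wedges -/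

section Region

theorem region_top_eq_logRegion {l R : ℝ} (hR : 0 < R) :
    region l ⊤ R = logRegion l 0 (Real.log R) := by
  ext x
  simp only [region, logRegion, mem_ofPred_eq, zero_mul, sub_zero, one_mul]
  constructor
  · rintro ⟨h₁, h₂⟩
    have hz : 0 < ‖x.1‖ := hR.trans h₁
    have hp : 0 < ‖x.1‖ ^ l := Real.rpow_pos_of_pos hz l
    have hw : 0 < ‖x.2‖ := (mul_pos hR hp).trans h₂
    have h₃ := Real.log_lt_log (mul_pos hR hp) h₂
    rw [Real.log_mul hR.ne' hp.ne', Real.log_rpow hz] at h₃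
    exact ⟨norm_pos_iff.1 hz, norm_pos_iff.1 hw, by linarith, Real.log_lt_log hR h₁⟩
  · rintro ⟨h₁, h₂, h₃, h₄⟩
    have hz := norm_pos_iff.2 h₁
    have hw := norm_pos_iff.2 h₂
    have hp : 0 < ‖x.1‖ ^ l := Real.rpow_pos_of_pos hz l
    refine ⟨(Real.log_lt_log_iff hR hz).1 h₄, (Real.log_lt_log_iff (mul_pos hR hp) hw).1 ?_⟩
    rw [Real.log_mul hR.ne' hp.ne', Real.log_rpow hz]
    linarith

theorem region_coe_eq_logRegion {l₁ l₂ R : ℝ} (hl₁ : 0 ≤ l₁) (hl₂ : 0 < l₂) (hR : 0 < R) :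
    region l₁ (l₂ : ℝ) R = logRegion l₁ (l₁ + l₂)⁻¹ (Real.log R) := by
  have hL : 0 < l₁ + l₂ := by linarith
  have hRp : 0 < R ^ l₂ := Real.rpow_pos_of_pos hR l₂
  have key : ∀ X Y : ℝ, (1 - (l₁ + l₂)⁻¹ * l₁) * Real.log R < X - (l₁ + l₂)⁻¹ * Y ↔
      l₂ * Real.log R + Y < (l₁ + l₂) * X := by
    intro X Y
    rw [← mul_lt_mul_iff_right₀ hL]
    have e₁ : (l₁ + l₂) * ((1 - (l₁ + l₂)⁻¹ * l₁) * Real.log R) = l₂ * Real.log R := by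
      field_simp
      ring
    have e₂ : (l₁ + l₂) * (X - (l₁ + l₂)⁻¹ * Y) = (l₁ + l₂) * X - Y := by
      field_simp
    rw [e₁, e₂]
    exact lt_sub_iff_add_lt
  ext x
  simp only [region, logRegion, mem_ofPred_eq, key]
  constructor
  · rintro ⟨h₁, h₂⟩
    have hz : 0 < ‖x.1‖ := by
      refine (norm_nonneg _).lt_of_ne fun h0 => ?_
      rw [← h0, Real.zero_rpow hL.ne'] at h₁
      exact absurd h₁ (mul_nonneg hRp.le (norm_nonneg _)).not_gt
    have hp : 0 < ‖x.1‖ ^ l₁ := Real.rpow_pos_of_pos hz l₁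
    have hw : 0 < ‖x.2‖ := (mul_pos hR hp).trans h₂
    have h₃ := Real.log_lt_log (mul_pos hR hp) h₂
    rw [Real.log_mul hR.ne' hp.ne', Real.log_rpow hz] at h₃
    have h₄ := Real.log_lt_log (mul_pos hRp hw) h₁
    rw [Real.log_mul hRp.ne' hw.ne', Real.log_rpow hz, Real.log_rpow hR] at h₄
    exact ⟨norm_pos_iff.1 hz, norm_pos_iff.1 hw, by linarith, h₄⟩
  · rintro ⟨h₁, h₂, h₃, h₄⟩
    have hz := norm_pos_iff.2 h₁
    have hw := norm_pos_iff.2 h₂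
    have hp : 0 < ‖x.1‖ ^ l₁ := Real.rpow_pos_of_pos hz l₁
    refine ⟨(Real.log_lt_log_iff (mul_pos hRp hw) (Real.rpow_pos_of_pos hz _)).1 ?_,
      (Real.log_lt_log_iff (mul_pos hR hp) hw).1 ?_⟩
    · rwa [Real.log_mul hRp.ne' hw.ne', Real.log_rpow hz, Real.log_rpow hR]
    · rw [Real.log_mul hR.ne' hp.ne', Real.log_rpow hz]
      linarith

end Region

/-! ### Inequalities for the dominant exponent -/

section Dominant

/-- The weight `l` and the reciprocal weight `κ = 1 / (l₁ + l₂)` of a dominant exponent, with the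
inequalities that they satisfy. -/
theorem IsDominant.exists_weights {q : MvPolynomial (Fin 2) ℂ} {δ s : ℕ} {n m : ℕ → ℕ}
    (hv : IsVertexList q s n m) (hq : 2 ≤ q.totalDegree) {γ d : ℕ} {l : ℝ} {l₂ : WithTop ℝ}
    (hdom : IsDominant δ s n m γ d l l₂)
    (hd : 2 ≤ d ∨ (d = 1 ∧ ∀ k : ℕ, 1 ≤ k → k + 1 ≤ s → (δ : ℝ) ≠ yIntercept n m k)) :
    ∃ κ : ℝ, 0 ≤ l ∧ 0 ≤ κ ∧ κ * l < 1 ∧ bCoeff q γ d ≠ 0 ∧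
      (∀ R : ℝ, 0 < R → region l l₂ R = logRegion l κ (Real.log R)) ∧
      (∀ i j : ℕ, bCoeff q i j ≠ 0 → ((i : ℝ) - γ) + l * ((j : ℝ) - d) ≤ 0 ∧
        κ * ((i : ℝ) - γ) + ((j : ℝ) - d) ≤ 0) ∧
      (l * δ ≤ γ + l * d ∧ (d = 1 → l * δ < γ + l * d)) ∧
      (κ = 0 ∨ (κ * γ + d ≤ δ ∧ (d = 1 → κ * γ + d < δ))) := by
  have hq0 : q ≠ 0 := by
    rintro rfl
    simp at hq
  have hne : d = 1 → ∀ k : ℕ, 1 ≤ k → k + 1 ≤ s → (δ : ℝ) ≠ yIntercept n m k := by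
    intro h
    rcases hd with hd | hd
    · omega
    · exact hd.2
  -- With w the edge weight, w T_k = n_k + w m_k, and the next vertex lies on the same line. Thus
  -- `left` and `right` restate the comparison of δ with T_k at the two ends of the edge.
  have left : ∀ k : ℕ, 1 ≤ k → k + 1 ≤ s → (δ : ℝ) ≤ yIntercept n m k →
      edgeWeight n m k * δ ≤ n k + edgeWeight n m k * m k ∧
        ((δ : ℝ) ≠ yIntercept n m k → edgeWeight n m k * δ < n k + edgeWeight n m k * m k) := by
    intro k hk hks h
    rw [← hv.mul_yIntercept hk hks]
    have hw := hv.edgeWeight_pos hk hks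
    exact ⟨mul_le_mul_of_nonneg_left h hw.le,
      fun h' => mul_lt_mul_of_pos_left (lt_of_le_of_ne h h') hw⟩
  have right : ∀ k : ℕ, 1 ≤ k → k + 1 ≤ s → yIntercept n m k ≤ (δ : ℝ) →
      (edgeWeight n m k)⁻¹ * n (k + 1) + m (k + 1) ≤ δ ∧
        ((δ : ℝ) ≠ yIntercept n m k → (edgeWeight n m k)⁻¹ * n (k + 1) + m (k + 1) < δ) := by
    intro k hk hks h
    have hw := hv.edgeWeight_pos hk hks
    have e : (edgeWeight n m k)⁻¹ * n (k + 1) + m (k + 1) = yIntercept n m k := by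
      refine mul_left_cancel₀ hw.ne' ?_
      rw [hv.mul_yIntercept hk hks, ← hv.edge_line hk hks, mul_add, mul_inv_cancel_left₀ hw.ne']
    rw [e]
    exact ⟨h, fun h' => lt_of_le_of_ne h h'.symm⟩
  have below_right : ∀ k : ℕ, 1 ≤ k → k + 1 ≤ s → ∀ i j : ℕ, bCoeff q i j ≠ 0 →
      (edgeWeight n m k)⁻¹ * ((i : ℝ) - n (k + 1)) + ((j : ℝ) - m (k + 1)) ≤ 0 := by
    intro k hk hks i j hij
    have hw := hv.edgeWeight_pos hk hks
    have h := hv.le_edge hq0 hk hks hij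
    rw [← hv.edge_line hk hks] at h
    refine le_of_mul_le_mul_left ?_ hw
    rw [mul_add, mul_inv_cancel_left₀ hw.ne']
    linarith
  have hn_pos : ∀ k : ℕ, 1 ≤ k → k + 1 ≤ s → (0 : ℝ) < n (k + 1) := fun k hk hks =>
    (Nat.cast_nonneg (n k)).trans_lt (hv.n_lt hk k.lt_succ_self hks)
  cases hdom with
  | case1 hs =>
    subst hs
    have hlast := fun i j (hij : bCoeff q i j ≠ 0) => hv.le_n_last hq0 hij
    have hfirst := fun i j (hij : bCoeff q i j ≠ 0) => hv.le_m_first hq0 hij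
    refine ⟨0, le_rfl, le_rfl, by norm_num, hv.bCoeff_ne_zero ⟨le_rfl, le_rfl⟩,
      fun R hR => region_top_eq_logRegion hR, fun i j hij => ?_, ⟨by simp, fun hd1 => ?_⟩,
      Or.inl rfl⟩
    · have h₁ : (i : ℝ) ≤ n 1 := Nat.cast_le.2 (hlast i j hij)
      have h₂ : (j : ℝ) ≤ m 1 := Nat.cast_le.2 (hfirst i j hij)
      constructor <;> linarith
    -- With a single vertex and d = 1, strictness cannot come from an intercept. If n₁ = 0, all
    -- exponents would be at most (0, 1), against deg q ≥ 2.
    · have : 0 < n 1 := by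
        by_contra h0
        have : q.totalDegree ≤ 1 := by
          refine Finset.sup_le fun t ht => ?_
          have hb := bCoeff_ne_zero_of_mem_support ht
          have h₁ := hlast _ _ hb
          have h₂ := hfirst _ _ hb
          rw [Finsupp.sum_fintype _ _ fun _ => rfl, Fin.sum_univ_two]
          omega
        omega
      simpa using this
  | case2 hs h =>
    have hE := left 1 le_rfl hs h
    refine ⟨0, (hv.edgeWeight_pos le_rfl hs).le, le_rfl, by norm_num,
      hv.bCoeff_ne_zero ⟨le_rfl, by omega⟩,
      fun R hR => region_top_eq_logRegion hR, fun i j hij => ⟨?_, ?_⟩,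
      ⟨hE.1, fun hd1 => hE.2 (hne hd1 1 le_rfl hs)⟩, Or.inl rfl⟩
    · linarith [hv.le_edge hq0 le_rfl hs hij]
    · have h₂ : (j : ℝ) ≤ m 1 := Nat.cast_le.2 (hv.le_m_first hq0 hij)
      linarith
  | case3 hs h =>
    obtain ⟨k, rfl⟩ : ∃ k, s = k + 1 := ⟨s - 1, by omega⟩
    rw [Nat.add_sub_cancel] at *
    have hk : 1 ≤ k := by omega
    have hE := right k hk le_rfl h
    have hn := hn_pos k hk le_rfl
    refine ⟨(edgeWeight n m k)⁻¹, le_rfl, (inv_pos.2 (hv.edgeWeight_pos hk le_rfl)).le, by norm_num,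
      hv.bCoeff_ne_zero ⟨by omega, le_rfl⟩, fun R hR => ?_, fun i j hij => ⟨?_, ?_⟩,
      ⟨by simp, fun _ => by simpa using hn⟩,
      Or.inr ⟨hE.1, fun hd1 => hE.2 (hne hd1 k hk le_rfl)⟩⟩
    · rw [region_coe_eq_logRegion le_rfl (hv.edgeWeight_pos hk le_rfl) hR, zero_add]
    · have h₂ : (i : ℝ) ≤ n (k + 1) := Nat.cast_le.2 (hv.le_n_last hq0 hij)
      linarith
    · exact below_right k hk le_rfl i j hij
  | case4 k hk hks h₁ h₂ =>
    obtain ⟨k, rfl⟩ : ∃ j, k = j + 1 := ⟨k - 1, by omega⟩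
    rw [Nat.add_sub_cancel] at *
    have hk' : 1 ≤ k := by omega
    have hks' : k + 1 ≤ s := by omega
    have hw := hv.edgeWeight_pos (k := k + 1) (by omega) hks
    have hw' := hv.edgeWeight_pos hk' hks'
    have hlt := hv.edgeWeight_succ_lt hk' hks
    have hE := left (k + 1) (by omega) hks h₂
    have hE' := right k hk' hks' h₁
    refine ⟨(edgeWeight n m k)⁻¹, hw.le, (inv_pos.2 hw').le, ?_,
      hv.bCoeff_ne_zero ⟨by omega, by omega⟩, fun R hR => ?_, fun i j hij => ⟨?_, ?_⟩,
      ⟨hE.1, fun hd1 => hE.2 (hne hd1 _ (by omega) hks)⟩,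
      Or.inr ⟨hE'.1, fun hd1 => hE'.2 (hne hd1 k hk' hks')⟩⟩
    · rwa [inv_mul_lt_iff₀ hw', mul_one]
    · rw [region_coe_eq_logRegion hw.le (sub_pos.2 hlt) hR, add_sub_cancel]
    · linarith [hv.le_edge hq0 (by omega) hks hij]
    · exact below_right k hk' hks' i j hij

end Dominant

/-! ### Application to the skew product -/

theorem differentiable_skewProduct (p : Polynomial ℂ) (q : MvPolynomial (Fin 2) ℂ) :
    Differentiable ℂ (skewProduct p q) := by
  refine Differentiable.prodMk (p.differentiable.comp differentiable_fst) ?_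
  simp only [MvPolynomial.eval_eq', Fin.prod_univ_two, Matrix.cons_val_zero, Matrix.cons_val_one]
  fun_prop

end SkewBottcher

end

theorem mainTheorem1
    (p : Polynomial ℂ) (q : MvPolynomial (Fin 2) ℂ) (δ : ℕ)
    (hpδ : p.natDegree = δ) (hδ : 2 ≤ δ) (hq : 2 ≤ q.totalDegree)
    (s : ℕ) (n m : ℕ → ℕ) (hv : SkewBottcher.IsVertexList q s n m)
    (γ d : ℕ) (l₁ : ℝ) (l₂ : WithTop ℝ)
    (hdom : SkewBottcher.IsDominant δ s n m γ d l₁ l₂)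
    (hd : 2 ≤ d ∨
      (d = 1 ∧ ∀ k : ℕ, 1 ≤ k → k + 1 ≤ s → (δ : ℝ) ≠ SkewBottcher.yIntercept n m k)) :
    ∃ R₀ : ℝ, 0 < R₀ ∧ ∃ φ : ℂ × ℂ → ℂ × ℂ,
      (∀ R : ℝ, R₀ ≤ R →
        Set.MapsTo (SkewBottcher.skewProduct p q)
          (SkewBottcher.region l₁ l₂ R) (SkewBottcher.region l₁ l₂ R) ∧
        SkewBottcher.IsBiholomorphicOn φ (SkewBottcher.region l₁ l₂ R) ∧
        ∀ x ∈ SkewBottcher.region l₁ l₂ R,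
          φ (SkewBottcher.skewProduct p q x) =
            SkewBottcher.monomialMap (p.coeff δ) (SkewBottcher.bCoeff q γ d) δ γ d (φ x)) ∧
      ∀ ε : ℝ, 0 < ε → ∃ R₁ : ℝ, R₀ ≤ R₁ ∧ ∀ R : ℝ, R₁ ≤ R →
        ∀ x ∈ SkewBottcher.region l₁ l₂ R,
          ‖(φ x).1 - x.1‖ < ε * ‖x.1‖ ∧ ‖(φ x).2 - x.2‖ < ε * ‖x.2‖ := by
  obtain ⟨κ, hl, hκ, hκl, hb, hreg, hbelow, ⟨hl₁, hl₁'⟩, hκ₁⟩ :=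
    hdom.exists_weights hv hq hd
  have hD : 0 < 1 - κ * l₁ := by linarith
  have hd1 : 1 ≤ d := by omega
  have hp0 : p.coeff δ ≠ 0 := by
    rw [← hpδ]
    refine mt Polynomial.leadingCoeff_eq_zero.1 ?_
    rintro rfl
    simp at hpδ
    omega
  have hpoly₁ : ∀ x : ℂ × ℂ, (SkewBottcher.skewProduct p q x).1 =
      ∑ t ∈ Finset.range (δ + 1), p.coeff t * (x.1 ^ t * x.2 ^ 0) := fun x => by
    simp [SkewBottcher.skewProduct, Polynomial.eval_eq_sum_range, hpδ]
  have hpoly₂ : ∀ x : ℂ × ℂ, (SkewBottcher.skewProduct p q x).2 =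
      ∑ t ∈ q.support, q.coeff t * (x.1 ^ t 0 * x.2 ^ t 1) := fun x => by
    simp [SkewBottcher.skewProduct, MvPolynomial.eval_eq']
  obtain ⟨C₁, e₁, he₁, hC₁⟩ := SkewBottcher.exists_norm_div_monomial_sub_one_le (l := l₁) hκl
    (Finset.range (δ + 1)) p.coeff (fun t => t) (fun _ => 0) (t₀ := δ) (by simp) hp0
    (fun t ht => by
      have : (t : ℝ) ≤ δ := Nat.cast_le.2 (Nat.lt_succ_iff.1 (Finset.mem_range.1 ht))
      simpa using this)
    (fun t ht => by
      have : (t : ℝ) ≤ δ := Nat.cast_le.2 (Nat.lt_succ_iff.1 (Finset.mem_range.1 ht))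
      simpa using mul_nonpos_of_nonneg_of_nonpos hκ (sub_nonpos.2 this))
    (fun t _ ht => Or.inl ht)
  set t₀ : Fin 2 →₀ ℕ := Finsupp.single 0 γ + Finsupp.single 1 d with ht₀
  have ht₀0 : t₀ 0 = γ := by simp [ht₀]
  have ht₀1 : t₀ 1 = d := by simp [ht₀]
  obtain ⟨C₂, e₂, he₂, hC₂⟩ := SkewBottcher.exists_norm_div_monomial_sub_one_le (l := l₁) hκl
    q.support q.coeff (fun t => t 0) (fun t => t 1) (t₀ := t₀) (MvPolynomial.mem_support_iff.2 hb)
    hb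
    (fun t ht => by
      rw [ht₀0, ht₀1]
      exact (hbelow _ _ (SkewBottcher.bCoeff_ne_zero_of_mem_support ht)).1)
    (fun t ht => by
      rw [ht₀0, ht₀1]
      exact (hbelow _ _ (SkewBottcher.bCoeff_ne_zero_of_mem_support ht)).2)
    (fun t _ ht => by
      by_contra! h
      refine ht (Finsupp.ext fun i => ?_)
      fin_cases i
      · exact h.1
      · exact h.2)
  have hd1r : (1 : ℝ) ≤ d := by exact_mod_cast hd1
  have hδr : (2 : ℝ) ≤ δ := by exact_mod_cast hδ
  obtain ⟨c₁, hc₁, hP⟩ : ∃ c : ℝ, 0 < c ∧ ∀ ρ X Y : ℝ, 0 ≤ ρ → ρ < Y - l₁ * X →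
      (1 - κ * l₁) * ρ < X - κ * Y → Y - l₁ * X + c * ρ ≤ γ * X + d * Y - l₁ * (δ * X) := by
    -- The increase of P is (d - 1)P + (γ + l₁d - l₁δ)X, with P and X both at least ρ. The constant
    -- is positive by its first term if d ≥ 2 and by its second if d = 1; `c₂` below is the analogue
    -- for Q.
    refine ⟨(d - 1) + (γ + l₁ * d - l₁ * δ), ?_, fun ρ X Y hρ h₁ h₂ => ?_⟩
    · rcases hd1.eq_or_lt with h | h
      · linarith [hl₁' h.symm]
      · have : (1 : ℝ) < d := by exact_mod_cast h
        linarith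
    · have hX := SkewBottcher.le_log_norm_fst hκ hκl hρ h₁ h₂
      have g₁ := mul_le_mul_of_nonneg_left h₁.le (sub_nonneg.2 hd1r)
      have g₂ := mul_le_mul_of_nonneg_left hX (sub_nonneg.2 hl₁)
      linarith
  obtain ⟨c₂, hc₂, hQ⟩ : ∃ c : ℝ, 0 < c ∧ ∀ ρ X Y : ℝ, 0 ≤ ρ → ρ < Y - l₁ * X →
      (1 - κ * l₁) * ρ < X - κ * Y → X - κ * Y + c * ρ ≤ δ * X - κ * (γ * X + d * Y) := by
    rcases hκ₁ with rfl | ⟨hκ₁, hκ₁'⟩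
    · refine ⟨1, one_pos, fun ρ X Y hρ h₁ h₂ => ?_⟩
      have hX := SkewBottcher.le_log_norm_fst hκ hκl hρ h₁ h₂
      have := mul_le_mul_of_nonneg_right hδr (hρ.trans hX)
      linarith
    · refine ⟨(d - 1) * (1 - κ * l₁) + (δ - (κ * γ + d)), ?_, fun ρ X Y hρ h₁ h₂ => ?_⟩
      · rcases hd1.eq_or_lt with h | h
        · have := mul_nonneg (sub_nonneg.2 hd1r) hD.le
          linarith [hκ₁' h.symm]
        · have : (1 : ℝ) < d := by exact_mod_cast h
          have := mul_pos (sub_pos.2 this) hD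
          linarith
      · have hX := SkewBottcher.le_log_norm_fst hκ hκl hρ h₁ h₂
        have g₁ := mul_le_mul_of_nonneg_left h₂.le (sub_nonneg.2 hd1r)
        have g₂ := mul_le_mul_of_nonneg_left hX (sub_nonneg.2 hκ₁)
        linarith
  obtain ⟨ρ₀, φ, hφ, hφε⟩ := SkewBottcher.exists_bottcher_coordinate hl hκ hκl
    (SkewBottcher.differentiable_skewProduct p q) hp0 hb (one_le_two.trans hδ) hd1 he₁ he₂
    (c := min c₁ c₂)
    (fun ρ hρ x hx => by simpa only [hpoly₁] using hC₁ ρ hρ x hx)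
    (fun ρ hρ x hx => by
      have h := hC₂ ρ hρ x hx
      rw [ht₀0, ht₀1] at h
      rw [hpoly₂]
      exact h)
    (lt_min hc₁ hc₂)
    (fun ρ X Y hρ h₁ h₂ => (add_le_add_right
      (mul_le_mul_of_nonneg_right (min_le_left _ _) hρ) _).trans (hP ρ X Y hρ h₁ h₂))
    (fun ρ X Y hρ h₁ h₂ => (add_le_add_right
      (mul_le_mul_of_nonneg_right (min_le_right _ _) hρ) _).trans (hQ ρ X Y hρ h₁ h₂))
  have hlog : ∀ {ρ R : ℝ}, Real.exp ρ ≤ R → 0 < R ∧ ρ ≤ Real.log R := fun {ρ R} h =>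
    have hR := (Real.exp_pos ρ).trans_le h
    ⟨hR, (Real.le_log_iff_exp_le hR).2 h⟩
  refine ⟨Real.exp ρ₀, Real.exp_pos _, φ, fun R hR => ?_, fun ε hε => ?_⟩
  · rw [hreg R (hlog hR).1]
    exact hφ _ (hlog hR).2
  · obtain ⟨ρ₁, hρ₁, h⟩ := hφε ε hε
    refine ⟨Real.exp ρ₁, Real.exp_le_exp.2 hρ₁, fun R hR => ?_⟩
    rw [hreg R (hlog hR).1]
    exact h _ (hlog hR).2
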